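/- Let $X=(X_t)_{0\le t\le 1}$ be a zero-mean Gaussian process with (almost surely) continuous paths, and let $\|Y\|_2=\sqrt{\mathbf E\,Y^2}$ denote the $L_2$-norm of a random variable $Y$. (i) If there exist $C>0$ and $H\in(0,1)$ such that $\|X_t-X_s\|_2\ge C|t-s|^H$ for all $t,s\in[0,1]$, then $\max_{0\le t\le1}X_t$ is integrable and $$\mathbf E\max_{0\le t\le 1}X_t\;\ge\;\frac{C}{\sqrt{4H\pi e\ln 2}}\;>\;\frac{C}{5\sqrt H}.$$ (ii) There is an absolute constant $L\in(0,\,3.75)$ with which both of the following statements hold. (a) (Generic chaining bound.) For every zero-mean Gaussian process $Y=(Y_t)_{0\le t\le1}$ with continuous paths, every $T\subset[0,1]$ and all sets $T_0\subset T_1\subset T_2\subset\cdots\subset T$ with $|T_0|=1$ and $|T_n|\le 2^{2^n}$ for $n\ge1$, the random variable $\sup_{t\in T}Y_t$ is integrable and $$\mathbf E\sup_{t\in T}Y_t\;\le\; L\,\sup_{t\in T}\sum_{n\ge0}2^{n/2}\min_{s\in T_n}\|Y_t-Y_s\|_2,$$ where the right-hand side may be $+\infty$. (b) If there exist $C>0$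 and $H\in(0,1)$ such that $\|X_t-X_s\|_2\le C|t-s|^H$ for all $t,s\in[0,1]$, then $\max_{0\le t\le1}X_t$ is integrable and $$\mathbf E\max_{0\le t\le 1}X_t\;\le\; LC\,\sqrt{\frac{2\pi}{H\ln^3 2}}\;\operatorname{erfc}\!\Bigl(\sqrt{\tfrac{\ln 2}{2}H}\Bigr)\;<\;\frac{16.3\,C}{\sqrt H},$$ where $\operatorname{erfc}(x)=\frac{2}{\sqrt\pi}\int_x^\infty e^{-t^2}\,dt$ and $\ln^3 2=(\ln 2)^3$. -/

import Mathlib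

open MeasureTheory ProbabilityTheory unitInterval
open scoped ENNReal

universe u

/-- The complementary error function. -/
noncomputable def erfc (x : ℝ) : ℝ :=
  2 / Real.sqrt Real.pi * ∫ t in Set.Ioi x, Real.exp (-t ^ 2)

/-- A zero-mean Gaussian process indexed by `[0, 1]` with almost surely continuous paths. -/
structure IsContinuousCenteredGaussian {Ω : Type u} [MeasurableSpace Ω]
    (X : I → Ω → ℝ) (P : Measure Ω) : Prop where
  gaussian : IsGaussianProcess X P
  centered : ∀ t, ∫ ω, X t ω ∂P = 0
  continuous_paths : ∀ᵐ ω ∂P, Continuous fun t => X t ω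

/-- The generic chaining bound with constant `L`: for every continuous zero-mean Gaussian process
on `[0, 1]`, every `T ⊆ [0, 1]` and all `T₀ ⊆ T₁ ⊆ ⋯ ⊆ T` with `|T₀| = 1` and `|Tₙ| ≤ 2 ^ 2 ^ n`
for `n ≥ 1`, the maximum over `T` is integrable and
`E max_{t ∈ T} X_t ≤ L * max_{t ∈ T} ∑ₙ 2 ^ (n / 2) * min_{s ∈ Tₙ} ‖X_t - X_s‖₂`.
The right-hand side may be infinite, so it is computed in `[0, ∞]`; the left-hand side is
nonnegative because the process has zero mean. -/
def GenericChainingBound (L : ℝ) : Prop :=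
  ∀ (Ω : Type u) [MeasurableSpace Ω] (P : Measure Ω) [IsProbabilityMeasure P] (X : I → Ω → ℝ),
    IsContinuousCenteredGaussian X P →
    ∀ (T : Set I) (A : ℕ → Finset I), Monotone A → (∀ n, (A n : Set I) ⊆ T) →
      (A 0).card = 1 → (∀ n, 1 ≤ n → (A n).card ≤ 2 ^ 2 ^ n) →
      Integrable (fun ω => ⨆ t : T, X t ω) P ∧
      ENNReal.ofReal (∫ ω, ⨆ t : T, X t ω ∂P) ≤
        ENNReal.ofReal L *
          ⨆ t ∈ T, ∑' n : ℕ, (2 : ℝ≥0∞) ^ ((n : ℝ) / 2) *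
            ⨅ s ∈ A n, eLpNorm (X t - X s) 2 P

/-! The maximum over the interval is a limit of maxima over finite sets of points, so both bounds
are statements about finite Gaussian vectors. Integrability comes from Fernique's theorem in a form
whose constants ignore the dimension: the exponential moment of the norm of a centered Gaussian
vector is controlled by one level that the norm stays below with probability above 1/2. Almost sure
boundedness of the paths supplies such a level for all finite subfamilies at once, and monotone
convergence makes sup |X_t| integrable.

Upper bound. Write X_t as a telescoping sum of links between nearest points in T_n and T_{n+1}. A
normalized link between these levels is compared with √2^(n+1) u, where u² = 3 log 2. This u is
chosen so that the Gaussian tail 2^(-3·2^n) cancels the number 2^(2^(n+1)) · 2^(2^n) of possible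
links; the excesses left over form a geometric series. Hence L = (1+√2)(u + excess), where 1+√2 is
the price of the triangle inequality. For Hölder increments, take for T_n the dyadic points of mesh
2^(-2^n). The chaining sum is then at most C Σ √2^n exp(-H log 2 · 2^n), and comparing its terms
with ∫ exp(-t²) over consecutive intervals of ratio √2 produces the erfc.

Lower bound. The Sudakov–Fernique inequality allows replacing X on 3^k points of spacing 3^(-k) by a
vector with smaller increments and computable maximum: Y_i = a Σ_j g_(j,i_j), with three independent
normal weights on each of k levels. Its squared increments are at most 2a²k, while its expected
maximum is a k · 3/(2√π), the last factor being the mean maximum of three standard normals. Choosing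
k near 1/(2H log 3) gives the claim; if this number is below 1, the two endpoints suffice. The
Sudakov–Fernique inequality itself is proved by interpolating log-sum-exp along sin θ · X + cos θ ·
Y and integrating by parts (`integral_logSumExp_le`). -/

/-! ### Fernique's theorem and integrability of suprema -/

section Integrability

variable {Ω : Type*} [MeasurableSpace Ω] {P : Measure Ω}

/-- A dimension-free form of Fernique's theorem for centered Gaussian vectors. -/
lemma ProbabilityTheory.HasGaussianLaw.lintegral_exp_mul_sq_norm_le {ι : Type*} [Fintype ι]
    {X : ι → Ω → ℝ} (hX : HasGaussianLaw (fun ω i => X i ω) P) (h0 : ∀ i, ∫ ω, X i ω ∂P = 0)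
    {a : ℝ} {c : ℝ≥0∞}
    (hc : c ≤ P {ω | ‖fun i => X i ω‖ ≤ a}) (hc_gt : 2⁻¹ < c) :
    ∫⁻ ω, ENNReal.ofReal
        (Real.exp (Fernique.logRatio c * a⁻¹ ^ 2 * ‖fun i => X i ω‖ ^ 2)) ∂P ≤
      ENNReal.ofReal (Real.exp (Fernique.logRatio c)) +
        ∑' n : ℕ, ENNReal.ofReal (Real.exp (-2⁻¹ * Real.log (c / (1 - c)).toReal * 2 ^ n)) := by
  have := hX.isGaussian_map
  have hm : AEMeasurable (fun ω i => X i ω) P := hX.aemeasurable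
  have hzero : ∫ x, id x ∂(P.map fun ω i => X i ω) = 0 := by
    rw [integral_map hm (by fun_prop)]
    ext i
    have := (ContinuousLinearMap.proj (R := ℝ) (φ := fun _ : ι => ℝ) i).integral_comp_comm
      hX.integrable
    simp only [ContinuousLinearMap.proj_apply] at this
    simp only [id, Pi.zero_apply]
    rw [← this, h0]
  have key := lintegral_exp_mul_sq_norm_le_of_map_rotation_eq_self
    (IsGaussian.map_rotation_eq_self hzero (-(Real.pi / 4))) (a := a) (c := c) ?_ hc_gt
  · rwa [lintegral_map' (by fun_prop) hm] at key
  · rwa [Measure.map_apply_of_aemeasurable hm (measurableSet_le (by fun_prop) (by fun_prop))]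

namespace IsContinuousCenteredGaussian

variable {X : I → Ω → ℝ}

lemma aemeasurable (hX : IsContinuousCenteredGaussian X P) (t : I) : AEMeasurable (X t) P :=
  hX.gaussian.aemeasurable t

lemma hasGaussianLaw_pi (hX : IsContinuousCenteredGaussian X P) {ι : Type*} [Fintype ι]
    (t : ι → I) : HasGaussianLaw (fun ω i => X (t i) ω) P := by
  have h := (hX.gaussian.comp_right t).hasGaussianLaw Finset.univ
  let L : ({i // i ∈ (Finset.univ : Finset ι)} → ℝ) →L[ℝ] (ι → ℝ) :=
    ContinuousLinearMap.pi fun i => ContinuousLinearMap.proj ⟨i, Finset.mem_univ i⟩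
  exact h.map L

/-- The paths of a continuous centered Gaussian process are dominated by an integrable variable. -/
lemma exists_integrable_bound (hX : IsContinuousCenteredGaussian X P) :
    ∃ M : Ω → ℝ, Integrable M P ∧ ∀ᵐ ω ∂P, ∀ t, |X t ω| ≤ M ω := by
  have hP := hX.gaussian.isProbabilityMeasure
  let d : ℕ → I := TopologicalSpace.denseSeq I
  let N : ℕ → Ω → ℝ := fun n ω => ‖fun i : Fin n => X (d i) ω‖
  have hNm : ∀ n, AEMeasurable (N n) P := fun n =>
    ((hX.hasGaussianLaw_pi fun i : Fin n => d i).aemeasurable).norm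
  have hNmono : ∀ ω, Monotone fun n => N n ω := fun ω m n hmn => by
    refine (pi_norm_le_iff_of_nonneg (norm_nonneg _)).2 fun i => ?_
    exact norm_le_pi_norm (fun i : Fin n => X (d i) ω) (Fin.castLE hmn i)
  let G : Ω → ℝ≥0∞ := fun ω => ⨆ n, ENNReal.ofReal (N n ω)
  have hGm : AEMeasurable G P := AEMeasurable.iSup fun n => (hNm n).ennreal_ofReal
  have hGfin : ∀ᵐ ω ∂P, G ω ≠ ∞ := by
    filter_upwards [hX.continuous_paths] with ω hω
    obtain ⟨b, hb⟩ := isCompact_univ.exists_bound_of_continuousOn hω.continuousOn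
    have hb0 : 0 ≤ b := (norm_nonneg _).trans (hb 0 (Set.mem_univ _))
    refine ne_top_of_le_ne_top (ENNReal.ofReal_ne_top (r := b)) (iSup_le fun n => ?_)
    exact ENNReal.ofReal_le_ofReal
      ((pi_norm_le_iff_of_nonneg hb0).2 fun i => hb _ (Set.mem_univ _))
  -- Any probability strictly between 1/2 and 1 would do in place of 3/4. The level `a` bounds the
  -- whole supremum `G`, so it serves every `N n` simultaneously.
  obtain ⟨a, ha0, ha⟩ : ∃ a : ℝ, 0 < a ∧ (3 / 4 : ℝ≥0∞) ≤ P {ω | G ω ≤ ENNReal.ofReal a} := by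
    have hmono : Monotone fun n : ℕ => {ω | G ω ≤ ENNReal.ofReal n} := fun m n hmn ω hω =>
      le_trans hω (ENNReal.ofReal_le_ofReal (by exact_mod_cast hmn))
    have hlim := tendsto_measure_iUnion_atTop (μ := P) hmono
    have hone : P (⋃ n : ℕ, {ω | G ω ≤ ENNReal.ofReal n}) = 1 := by
      rw [← measure_univ (μ := P)]
      refine measure_congr ?_
      filter_upwards [hGfin] with ω hω
      simp only [eq_iff_iff]
      refine ⟨fun _ => trivial, fun _ => ?_⟩
      obtain ⟨n, hn⟩ := ENNReal.exists_nat_gt hω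
      exact Set.mem_iUnion.2 ⟨n, by simpa using hn.le⟩
    rw [hone] at hlim
    have hlt : (3 / 4 : ℝ≥0∞) < 1 := by
      rw [ENNReal.div_lt_iff (by simp) (by simp)]; norm_num
    obtain ⟨n, hn1, hn2⟩ := ((hlim.eventually (lt_mem_nhds hlt)).and
      (Filter.eventually_gt_atTop 0)).exists
    exact ⟨n, by exact_mod_cast hn2, hn1.le⟩
  have hc_gt : (2⁻¹ : ℝ≥0∞) < 3 / 4 := by
    rw [ENNReal.lt_div_iff_mul_lt (by simp) (by simp), show (4 : ℝ≥0∞) = 2 * 2 by norm_num,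
      ← mul_assoc, ENNReal.inv_mul_cancel (by simp) (by simp)]
    norm_num
  have hc_lt : (3 / 4 : ℝ≥0∞) < 1 := by
    rw [ENNReal.div_lt_iff (by simp) (by simp)]; norm_num
  have hratio : ((3 / 4 : ℝ≥0∞) / (1 - 3 / 4)).toReal = 3 := by
    rw [ENNReal.toReal_div, ENNReal.toReal_sub_of_le hc_lt.le (by simp), ENNReal.toReal_div]
    norm_num
  set κ := Fernique.logRatio (3 / 4) * a⁻¹ ^ 2 with hκ
  have hκ0 : 0 < κ := mul_pos (Fernique.logRatio_pos hc_gt hc_lt) (by positivity)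
  set B : ℝ≥0∞ := ENNReal.ofReal (Real.exp (Fernique.logRatio (3 / 4))) +
    ∑' n : ℕ, ENNReal.ofReal
      (Real.exp (-2⁻¹ * Real.log ((3 / 4 : ℝ≥0∞) / (1 - 3 / 4)).toReal * 2 ^ n)) with hB
  have hBtop : B ≠ ∞ := by
    refine ENNReal.add_ne_top.2 ⟨ENNReal.ofReal_ne_top, ne_of_lt ?_⟩
    refine Summable.tsum_ofReal_lt_top <|
      Real.summable_exp_nat_mul_of_ge ?_ (fun i => mod_cast (Nat.lt_pow_self (by simp)).le)
    rw [hratio]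
    exact mul_neg_of_neg_of_pos (by simp) (Real.log_pos (by norm_num))
  have hbound : ∀ n, ∫⁻ ω, ENNReal.ofReal (N n ω) ∂P ≤ 1 + ENNReal.ofReal κ⁻¹ * B := by
    intro n
    have h1 : ∫⁻ ω, ENNReal.ofReal (Real.exp (κ * N n ω ^ 2)) ∂P ≤ B := by
      refine HasGaussianLaw.lintegral_exp_mul_sq_norm_le
        (hX.hasGaussianLaw_pi fun i : Fin n => d i) (fun i => hX.centered _) (ha.trans ?_) hc_gt
      refine measure_mono fun ω hω => ?_
      have : ENNReal.ofReal (N n ω) ≤ ENNReal.ofReal a :=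
        (le_iSup (fun n => ENNReal.ofReal (N n ω)) n).trans hω
      exact (ENNReal.ofReal_le_ofReal_iff ha0.le).1 this
    calc ∫⁻ ω, ENNReal.ofReal (N n ω) ∂P
        ≤ ∫⁻ ω, (1 + ENNReal.ofReal κ⁻¹ * ENNReal.ofReal (Real.exp (κ * N n ω ^ 2))) ∂P := by
          refine lintegral_mono fun ω => ?_
          rw [← ENNReal.ofReal_one, ← ENNReal.ofReal_mul (by positivity),
            ← ENNReal.ofReal_add (by positivity) (by positivity)]
          refine ENNReal.ofReal_le_ofReal ?_
          -- Uses N ≤ 1 + N² and κN² ≤ exp(κN²).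
          have := Real.add_one_le_exp (κ * N n ω ^ 2)
          have h2 : κ⁻¹ * (κ * N n ω ^ 2) ≤ κ⁻¹ * Real.exp (κ * N n ω ^ 2) := by
            gcongr; linarith
          rw [inv_mul_cancel_left₀ hκ0.ne'] at h2
          nlinarith [sq_nonneg (N n ω - 1)]
      _ ≤ 1 + ENNReal.ofReal κ⁻¹ * B := by
          rw [lintegral_add_left measurable_const, lintegral_const, measure_univ, mul_one,
            lintegral_const_mul' _ _ ENNReal.ofReal_ne_top]
          gcongr
  have hGint : ∫⁻ ω, G ω ∂P ≠ ∞ := by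
    refine ne_top_of_le_ne_top (b := 1 + ENNReal.ofReal κ⁻¹ * B) ?_ ?_
    · exact ENNReal.add_ne_top.2 ⟨by simp, ENNReal.mul_ne_top ENNReal.ofReal_ne_top hBtop⟩
    · rw [lintegral_iSup' (fun n => (hNm n).ennreal_ofReal)
        (Filter.Eventually.of_forall fun ω m n hmn => ENNReal.ofReal_le_ofReal (hNmono ω hmn))]
      exact iSup_le hbound
  refine ⟨fun ω => (G ω).toReal, integrable_toReal_of_lintegral_ne_top hGm hGint, ?_⟩
  filter_upwards [hX.continuous_paths, hGfin] with ω hω hfin t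
  refine (TopologicalSpace.denseRange_denseSeq I).induction_on
    (p := fun t => |X t ω| ≤ (G ω).toReal) t
    (isClosed_le hω.abs continuous_const) fun n => ?_
  have h1 : |X (d n) ω| ≤ N (n + 1) ω :=
    norm_le_pi_norm (fun i : Fin (n + 1) => X (d i) ω) (Fin.last n)
  refine h1.trans ?_
  rw [← ENNReal.toReal_ofReal (show 0 ≤ N (n + 1) ω from norm_nonneg _)]
  exact ENNReal.toReal_mono hfin (le_iSup (fun n => ENNReal.ofReal (N n ω)) (n + 1))

lemma integrable_eval (hX : IsContinuousCenteredGaussian X P) (t : I) : Integrable (X t) P :=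
  (hX.gaussian.hasGaussianLaw_eval t).integrable

lemma integrable_iSup_countable (hX : IsContinuousCenteredGaussian X P) {κ : Type*} [Countable κ]
    [Nonempty κ] (f : κ → I) : Integrable (fun ω => ⨆ i, X (f i) ω) P := by
  obtain ⟨M, hMi, hM⟩ := hX.exists_integrable_bound
  refine hMi.mono' (AEMeasurable.iSup fun i => hX.aemeasurable (f i)).aestronglyMeasurable ?_
  filter_upwards [hM] with ω hω
  have hb : BddAbove (Set.range fun i => X (f i) ω) :=
    ⟨M ω, by rintro _ ⟨i, rfl⟩; exact (le_abs_self _).trans (hω _)⟩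
  refine abs_le.2 ⟨?_, ciSup_le fun i => (le_abs_self _).trans (hω _)⟩
  obtain ⟨i⟩ := ‹Nonempty κ›
  exact (neg_le_of_abs_le (hω (f i))).trans (le_ciSup hb i)

/-- Path continuity turns a supremum over a possibly uncountable set into a countable one, which is
what makes it measurable up to a null set. -/
lemma ae_iSup_eq_iSup_denseSeq (hX : IsContinuousCenteredGaussian X P) (T : Set I) [Nonempty T] :
    (fun ω => ⨆ t : T, X t ω) =ᵐ[P]
      fun ω => ⨆ n, X (TopologicalSpace.denseSeq T n : T) ω := by
  obtain ⟨M, hMi, hM⟩ := hX.exists_integrable_bound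
  filter_upwards [hM, hX.continuous_paths] with ω hω hc
  have hb : ∀ {κ : Type} (f : κ → I), BddAbove (Set.range fun i => X (f i) ω) := fun f =>
    ⟨M ω, by rintro _ ⟨i, rfl⟩; exact (le_abs_self _).trans (hω _)⟩
  refine le_antisymm (ciSup_le fun t => ?_) (ciSup_le fun n => le_ciSup (hb fun t : T => (t : I)) _)
  refine (TopologicalSpace.denseRange_denseSeq T).induction_on
    (p := fun t : T => X t ω ≤ ⨆ n, X (TopologicalSpace.denseSeq T n : T) ω) t
    (isClosed_le (hc.comp continuous_subtype_val) continuous_const) fun n => ?_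
  exact le_ciSup (hb fun n => ((TopologicalSpace.denseSeq T n : T) : I)) n

lemma integrable_iSup (hX : IsContinuousCenteredGaussian X P) (T : Set I) [Nonempty T] :
    Integrable (fun ω => ⨆ t : T, X t ω) P :=
  (hX.integrable_iSup_countable fun n => ((TopologicalSpace.denseSeq T n : T) : I)).congr
    (hX.ae_iSup_eq_iSup_denseSeq T).symm

/-- Reduces bounds on suprema to finite families: the maxima over initial segments of a dense
sequence increase to the supremum almost surely and are dominated by the integrable bound on the
paths. -/
lemma integral_iSup_le (hX : IsContinuousCenteredGaussian X P) (T : Set I) [Nonempty T] {B : ℝ}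
    (hB : ∀ (n : ℕ) (f : Fin (n + 1) → T), ∫ ω, ⨆ i, X (f i) ω ∂P ≤ B) :
    ∫ ω, ⨆ t : T, X t ω ∂P ≤ B := by
  obtain ⟨M, hMi, hM⟩ := hX.exists_integrable_bound
  rw [integral_congr_ae (hX.ae_iSup_eq_iSup_denseSeq T)]
  let d : ℕ → T := TopologicalSpace.denseSeq T
  have hlim : Filter.Tendsto (fun n : ℕ => ∫ ω, ⨆ i : Fin (n + 1), X (d i) ω ∂P) Filter.atTop
      (nhds (∫ ω, ⨆ n, X (d n) ω ∂P)) := by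
    refine tendsto_integral_of_dominated_convergence M
      (fun n => (hX.integrable_iSup_countable fun i : Fin (n + 1) => (d i : I)).1) hMi ?_ ?_
    · intro n
      filter_upwards [hM] with ω hω
      refine abs_le.2 ⟨?_, ciSup_le fun i => (le_abs_self _).trans (hω _)⟩
      exact (neg_le_of_abs_le (hω (d 0))).trans
        (le_ciSup (f := fun i : Fin (n + 1) => X (d i) ω) (Set.finite_range _).bddAbove 0)
    · filter_upwards [hM] with ω hω
      have hb : BddAbove (Set.range fun i => X (d i) ω) :=
        ⟨M ω, by rintro _ ⟨i, rfl⟩; exact (le_abs_self _).trans (hω _)⟩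
      refine tendsto_order.2 ⟨fun c hc => ?_, fun c hc => Filter.Eventually.of_forall fun n => ?_⟩
      · obtain ⟨m, hm⟩ := exists_lt_of_lt_ciSup hc
        filter_upwards [Filter.eventually_ge_atTop m] with n hn
        exact hm.trans_le (le_ciSup (f := fun i : Fin (n + 1) => X (d i) ω)
          (Set.finite_range _).bddAbove ⟨m, by omega⟩)
      · exact lt_of_le_of_lt (ciSup_le fun i : Fin (n + 1) => le_ciSup hb (i : ℕ)) hc
  exact le_of_tendsto' hlim fun n => hB n fun i => d i

lemma integrable_iSup_univ (hX : IsContinuousCenteredGaussian X P) :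
    Integrable (fun ω => ⨆ t, X t ω) P :=
  (hX.integrable_iSup Set.univ).congr (Filter.Eventually.of_forall fun ω =>
    (Equiv.Set.univ I).iSup_comp (g := fun t => X t ω))

lemma integral_iSup_finite_le (hX : IsContinuousCenteredGaussian X P) {κ : Type*} [Finite κ]
    [Nonempty κ] (f : κ → I) : ∫ ω, ⨆ i, X (f i) ω ∂P ≤ ∫ ω, ⨆ t, X t ω ∂P := by
  obtain ⟨M, hMi, hM⟩ := hX.exists_integrable_bound
  refine integral_mono_ae (hX.integrable_iSup_countable f) hX.integrable_iSup_univ ?_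
  filter_upwards [hM] with ω hω
  refine ciSup_le fun i => le_ciSup (f := fun t => X t ω) ?_ (f i)
  exact ⟨M ω, by rintro _ ⟨i, rfl⟩; exact (le_abs_self _).trans (hω _)⟩

end IsContinuousCenteredGaussian

end Integrability

/-! ### One-dimensional Gaussian moments, tails and integration by parts -/

section GaussianReal

open scoped NNReal

lemma gaussianPDFReal_zero_one (x : ℝ) :
    gaussianPDFReal 0 1 x = (Real.sqrt (2 * Real.pi))⁻¹ * Real.exp (-(x ^ 2) / 2) := by
  simp [gaussianPDFReal]

/-- The first absolute moment of a centered Gaussian variable. -/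
lemma integral_abs_gaussianReal (v : ℝ≥0) :
    ∫ x, |x| ∂(gaussianReal 0 v) = Real.sqrt (2 * v / Real.pi) := by
  rcases eq_or_ne v 0 with rfl | hv
  · simp
  have hv0 : (0 : ℝ) < v := by positivity
  rw [integral_gaussianReal_eq_integral_smul hv]
  have h1 : ∀ x : ℝ, gaussianPDFReal 0 v x • |x| =
      (fun y => (Real.sqrt (2 * Real.pi * v))⁻¹ * (y ^ (1 : ℝ) *
        Real.exp (-(2 * (v : ℝ))⁻¹ * y ^ (2 : ℝ)))) |x| := by
    intro x
    simp only [gaussianPDFReal, smul_eq_mul, Real.rpow_one, Real.rpow_two, sq_abs, sub_zero]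
    rw [mul_assoc, mul_comm |x|]
    congr 3
    field_simp
  simp_rw [h1]
  rw [integral_comp_abs (f := fun y => (Real.sqrt (2 * Real.pi * v))⁻¹ * (y ^ (1 : ℝ) *
        Real.exp (-(2 * (v : ℝ))⁻¹ * y ^ (2 : ℝ)))), integral_const_mul,
    integral_rpow_mul_exp_neg_mul_rpow (by norm_num) (by norm_num) (by positivity)]
  have h2 : (((2 : ℝ) * v)⁻¹) ^ (-(1 + 1) / 2 : ℝ) = 2 * v := by
    rw [show (-(1 + 1) / 2 : ℝ) = -1 by norm_num, Real.rpow_neg_one, inv_inv]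
  have h3 : Real.Gamma ((1 + 1) / 2) = 1 := by norm_num
  rw [h2, h3, eq_comm, Real.sqrt_eq_iff_mul_self_eq (by positivity) (by positivity)]
  field_simp
  rw [Real.sq_sqrt (by positivity)]

/-- With y = x + z and z > 0, exp(-y²/2) ≤ exp(-x²/2) exp(-xz), and ∫ z exp(-xz) dz = 1/x² over the
half-line. -/
lemma integral_posPart_sub_gaussianReal_le {x : ℝ} (hx : 0 < x) :
    ∫ y, max (y - x) 0 ∂(gaussianReal 0 1) ≤
      (Real.sqrt (2 * Real.pi))⁻¹ * Real.exp (-(x ^ 2) / 2) / x ^ 2 := by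
  rw [integral_gaussianReal_eq_integral_smul one_ne_zero]
  let h : ℝ → ℝ := (Set.Ioi 0).indicator fun z => z ^ ((2 : ℝ) - 1) * Real.exp (-(x * z))
  have hint : IntegrableOn (fun z => z ^ ((2 : ℝ) - 1) * Real.exp (-(x * z))) (Set.Ioi 0) := by
    have := integrableOn_rpow_mul_exp_neg_mul_rpow (p := 1) (s := 1) (b := x)
      (by norm_num) one_pos hx
    refine this.congr_fun (fun z _ => ?_) measurableSet_Ioi
    norm_num
  have hh : Integrable h := (integrable_indicator_iff measurableSet_Ioi).2 hint
  have hval : ∫ z, h z = (x ^ 2)⁻¹ := by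
    rw [integral_indicator measurableSet_Ioi,
      Real.integral_rpow_mul_exp_neg_mul_Ioi (by norm_num) hx, Real.Gamma_two]
    simp
  calc ∫ y, gaussianPDFReal 0 1 y • max (y - x) 0
      ≤ ∫ y, (Real.sqrt (2 * Real.pi))⁻¹ * Real.exp (-(x ^ 2) / 2) * h (y - x) := by
        refine integral_mono_of_nonneg (Filter.Eventually.of_forall fun y => ?_)
          ((hh.comp_sub_right x).const_mul _) (Filter.Eventually.of_forall fun y => ?_)
        · exact mul_nonneg (gaussianPDFReal_nonneg _ _ _) (le_max_right _ _)
        · simp only [gaussianPDFReal_zero_one, smul_eq_mul, h]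
          rcases le_or_gt y x with hy | hy
          · rw [max_eq_right (by linarith), Set.indicator_of_notMem (by simp [hy])]
            simp
          · rw [max_eq_left (by linarith), Set.indicator_of_mem (by simpa using hy)]
            rw [show (2 : ℝ) - 1 = 1 by norm_num, Real.rpow_one, mul_assoc, mul_assoc]
            refine mul_le_mul_of_nonneg_left ?_ (by positivity)
            rw [mul_comm, mul_left_comm, ← Real.exp_add]
            refine mul_le_mul_of_nonneg_left (Real.exp_le_exp.2 ?_) (by linarith)
            nlinarith [sq_nonneg (y - x)]
    _ = _ := by
        rw [integral_const_mul, integral_sub_right_eq_self h, hval]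
        rfl

/-- **Stein's identity**: integration by parts for a centered Gaussian measure. -/
lemma integral_mul_gaussianReal (v : ℝ≥0) {f f' : ℝ → ℝ} {K : ℝ}
    (hf : ∀ x, HasDerivAt f (f' x) x) (hf' : Measurable f') (hK : ∀ x, |f x| ≤ K)
    (hK' : ∀ x, |f' x| ≤ K) :
    ∫ x, x * f x ∂(gaussianReal 0 v) = v * ∫ x, f' x ∂(gaussianReal 0 v) := by
  rcases eq_or_ne v 0 with rfl | hv
  · simp
  have hv0 : (v : ℝ) ≠ 0 := by positivity
  have hfm : Measurable f :=
    (continuous_iff_continuousAt.2 fun x => (hf x).continuousAt).measurable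
  have hpdf : ∀ x, HasDerivAt (gaussianPDFReal 0 v) (-(x / v) * gaussianPDFReal 0 v x) x := by
    intro x
    have h1 : HasDerivAt (fun x : ℝ => -(x - 0) ^ 2 / (2 * v)) (-(x / v)) x := by
      have := (((hasDerivAt_id x).sub_const 0).pow 2).neg.div_const (2 * (v : ℝ))
      convert! this using 1
      simp
      field_simp
    convert! (h1.exp.const_mul (Real.sqrt (2 * Real.pi * v))⁻¹) using 1
    simp only [gaussianPDFReal]
    ring
  have hi := integrable_gaussianPDFReal 0 v
  have hix : Integrable fun x => x * gaussianPDFReal 0 v x := by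
    have h := (memLp_id_gaussianReal' (μ := 0) (v := v) 1 (by simp)).integrable le_rfl
    rw [gaussianReal_of_var_ne_zero _ hv, integrable_withDensity_iff_integrable_smul'
      (measurable_gaussianPDF _ _) (by simp [gaussianPDF])] at h
    refine h.congr (Filter.Eventually.of_forall fun x => ?_)
    simp [toReal_gaussianPDF, mul_comm]
  -- The density p satisfies x p = -v p', so the identity is integration by parts on the line; the
  -- boundary terms vanish because f p, f p' and f' p are integrable.
  have key := integral_mul_deriv_eq_deriv_mul_of_integrable
    (u := f) (v := gaussianPDFReal 0 v) (u' := f') (v' := fun x => -(x / v) * gaussianPDFReal 0 v x)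
    (fun x _ => hf x) (fun x _ => hpdf x) ?_ ?_ ?_
  · rw [integral_gaussianReal_eq_integral_smul hv, integral_gaussianReal_eq_integral_smul hv]
    have h1 : ∀ x, gaussianPDFReal 0 v x • (x * f x) =
        -(v : ℝ) * (f x * (-(x / v) * gaussianPDFReal 0 v x)) := by
      intro x
      simp only [smul_eq_mul]
      field_simp
    simp_rw [h1]
    rw [integral_const_mul, key]
    simp [mul_comm]
  · have : Integrable fun x => f x * (-(v : ℝ)⁻¹ * (x * gaussianPDFReal 0 v x)) :=
      (hix.const_mul _).bdd_mul hfm.aestronglyMeasurable (Filter.Eventually.of_forall hK)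
    refine this.congr (Filter.Eventually.of_forall fun x => ?_)
    simp only [Pi.mul_apply]
    ring
  · exact hi.bdd_mul hf'.aestronglyMeasurable (Filter.Eventually.of_forall hK')
  · exact hi.bdd_mul hfm.aestronglyMeasurable (Filter.Eventually.of_forall hK)

variable {Ω : Type*} [MeasurableSpace Ω] {P : Measure Ω}

/-- A centered Gaussian variable has first absolute moment `√(2 / π)` times its deviation. -/
lemma ProbabilityTheory.HasGaussianLaw.integral_abs {Y : Ω → ℝ}
    (hY : HasGaussianLaw Y P) (h0 : ∫ ω, Y ω ∂P = 0) :
    ∫ ω, |Y ω| ∂P = Real.sqrt (2 * Var[Y; P] / Real.pi) := by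
  have h := integral_map (μ := P) (φ := Y) hY.aemeasurable (f := fun y => |y|)
    (by fun_prop)
  rw [← h, hY.map_eq_gaussianReal, h0, integral_abs_gaussianReal,
    Real.coe_toNNReal _ (variance_nonneg _ _)]

/-- The previous tail bound after rescaling: the positive part equals m⁻¹ (g - m u)⁺ with g standard
normal. In chaining, m is the weight √2^n of the level and u the threshold. -/
lemma ProbabilityTheory.HasGaussianLaw.integral_posPart_div_sub_le {Y : Ω → ℝ}
    (hY : HasGaussianLaw Y P) (h0 : ∫ ω, Y ω ∂P = 0) {m u : ℝ} (hm : 0 < m) (hu : 0 < u) :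
    ∫ ω, max (Y ω / (Real.sqrt Var[Y; P] * m) - u) 0 ∂P ≤
      (Real.sqrt (2 * Real.pi))⁻¹ * Real.exp (-((m * u) ^ 2) / 2) / ((m * u) ^ 2 * m) := by
  have hP := hY.isProbabilityMeasure
  -- For zero variance the quotient is 0 by the convention on division, and -u is negative.
  rcases (variance_nonneg Y P).eq_or_lt with hv | hv
  · have : ∀ ω, max (Y ω / (Real.sqrt Var[Y; P] * m) - u) 0 = 0 := by
      intro ω
      rw [← hv]
      simp [hu.le]
    simp_rw [this]
    rw [integral_zero]
    positivity
  have hlaw : P.map (fun ω => Y ω / Real.sqrt Var[Y; P]) = gaussianReal 0 1 := by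
    have h := hY.map_eq_gaussianReal
    have h' : P.map (fun ω => Y ω / Real.sqrt Var[Y; P]) =
        (P.map Y).map fun y => y / Real.sqrt Var[Y; P] := by
      rw [AEMeasurable.map_map_of_aemeasurable (by fun_prop) hY.aemeasurable]
      rfl
    rw [h', h, gaussianReal_map_div_const, h0, zero_div]
    congr 1
    ext
    simp [Real.sq_sqrt hv.le, Real.coe_toNNReal _ hv.le, hv.ne']
  have hmap := integral_map (μ := P) (φ := fun ω => Y ω / Real.sqrt Var[Y; P])
    (hY.aemeasurable.div_const _) (f := fun y => max (y - m * u) 0) (by fun_prop)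
  have heq : ∀ ω, max (Y ω / (Real.sqrt Var[Y; P] * m) - u) 0 =
      m⁻¹ * max (Y ω / Real.sqrt Var[Y; P] - m * u) 0 := by
    intro ω
    rw [mul_max_of_nonneg _ _ (by positivity)]
    congr 1
    · field_simp
    · simp
  simp_rw [heq]
  rw [integral_const_mul, ← hmap, hlaw]
  calc m⁻¹ * ∫ y, max (y - m * u) 0 ∂(gaussianReal 0 1)
      ≤ m⁻¹ * ((Real.sqrt (2 * Real.pi))⁻¹ * Real.exp (-((m * u) ^ 2) / 2) / (m * u) ^ 2) := by
        gcongr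
        exact integral_posPart_sub_gaussianReal_le (by positivity)
    _ = _ := by
        field_simp

end GaussianReal

/-! ### The generic chaining bound -/

section GenericChaining

/-- The canonical distance `‖X s - X t‖₂` of a centered process. -/
noncomputable def canonicalDist {Ω : Type*} [MeasurableSpace Ω] (X : I → Ω → ℝ) (P : Measure Ω)
    (s t : I) : ℝ :=
  Real.sqrt Var[X s - X t; P]

/-- The threshold above which the union bound over the chaining links is effective. -/
noncomputable def chainingThreshold : ℝ := Real.sqrt (3 * Real.log 2)

/-- The expected excess over the threshold of all normalized chaining links. -/
noncomputable def chainingExcess : ℝ :=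
  (Real.sqrt (2 * Real.pi))⁻¹ * (3 * Real.log 2)⁻¹ * (2 * Real.sqrt 2 - 1)⁻¹

/-- An explicit constant for the generic chaining bound. -/
noncomputable def chainingConstant : ℝ :=
  (1 + Real.sqrt 2) * (chainingThreshold + chainingExcess)

lemma one_lt_two_mul_sqrt_two : 1 < 2 * Real.sqrt 2 := by
  have : 1 < Real.sqrt 2 := by
    rw [Real.lt_sqrt (by norm_num)]; norm_num
  linarith

lemma chainingThreshold_pos : 0 < chainingThreshold :=
  Real.sqrt_pos.2 (mul_pos (by norm_num) (Real.log_pos (by norm_num)))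

lemma chainingExcess_pos : 0 < chainingExcess := by
  have h1 := one_lt_two_mul_sqrt_two
  have h2 := Real.log_pos (x := 2) (by norm_num)
  have h3 : 0 < (2 * Real.sqrt 2 - 1)⁻¹ := inv_pos.2 (by linarith)
  unfold chainingExcess
  have := Real.pi_pos
  positivity

lemma chainingConstant_pos : 0 < chainingConstant := by
  have := chainingThreshold_pos
  have := chainingExcess_pos
  unfold chainingConstant
  positivity

lemma chainingConstant_lt : chainingConstant < 3.75 := by
  have hl := Real.log_two_gt_d9
  have hl' := Real.log_two_lt_d9
  have hpi := Real.pi_gt_d2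
  have hs : Real.sqrt 2 < 1.41422 := by
    rw [Real.sqrt_lt' (by norm_num)]; norm_num
  have hs' : 1.4142 < Real.sqrt 2 := by
    rw [Real.lt_sqrt (by norm_num)]; norm_num
  have hu : chainingThreshold < 1.4421 := by
    unfold chainingThreshold
    rw [Real.sqrt_lt' (by norm_num)]; norm_num; linarith
  have hp : 2.505 < Real.sqrt (2 * Real.pi) := by
    rw [Real.lt_sqrt (by norm_num)]; norm_num; linarith
  have he : chainingExcess < 0.106 := by
    unfold chainingExcess
    rw [← mul_inv, ← mul_inv, inv_lt_comm₀ (by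
      have : 0 < 2 * Real.sqrt 2 - 1 := by linarith
      positivity) (by norm_num)]
    have h1 : 2.505 * 2.0794 < Real.sqrt (2 * Real.pi) * (3 * Real.log 2) := by
      apply mul_lt_mul'' hp (by linarith) <;> norm_num
    have h2 : 2.505 * 2.0794 * 1.8284 <
        Real.sqrt (2 * Real.pi) * (3 * Real.log 2) * (2 * Real.sqrt 2 - 1) := by
      apply mul_lt_mul'' h1 (by linarith) <;> norm_num
    refine lt_trans ?_ h2
    norm_num
  have h0 := chainingThreshold_pos
  have h0' := chainingExcess_pos
  unfold chainingConstant
  calc (1 + Real.sqrt 2) * (chainingThreshold + chainingExcess)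
      < 2.41422 * (1.4421 + 0.106) := by
        apply mul_lt_mul'' (by linarith) (by linarith) (by positivity) (by positivity)
    _ < 3.75 := by norm_num

namespace IsContinuousCenteredGaussian

variable {Ω : Type*} [MeasurableSpace Ω] {P : Measure Ω} {X : I → Ω → ℝ}

lemma hasGaussianLaw_sub (hX : IsContinuousCenteredGaussian X P) (s t : I) :
    HasGaussianLaw (X s - X t) P := hX.gaussian.hasGaussianLaw_sub

lemma integral_sub_eq_zero (hX : IsContinuousCenteredGaussian X P) (s t : I) :
    ∫ ω, (X s - X t) ω ∂P = 0 := by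
  simp only [Pi.sub_apply]
  rw [integral_sub (hX.integrable_eval s) (hX.integrable_eval t), hX.centered, hX.centered,
    sub_zero]

lemma eLpNorm_sub (hX : IsContinuousCenteredGaussian X P) (s t : I) :
    eLpNorm (X s - X t) 2 P = ENNReal.ofReal (canonicalDist X P s t) := by
  have h := (hX.hasGaussianLaw_sub s t).memLp_two
  rw [h.eLpNorm_eq_integral_rpow_norm (by simp) (by simp), canonicalDist,
    variance_of_integral_eq_zero h.aemeasurable (hX.integral_sub_eq_zero s t), Real.sqrt_eq_rpow]
  simp

lemma canonicalDist_nonneg (s t : I) : 0 ≤ canonicalDist X P s t := Real.sqrt_nonneg _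

lemma canonicalDist_triangle (hX : IsContinuousCenteredGaussian X P) (r s t : I) :
    canonicalDist X P r t ≤ canonicalDist X P s r + canonicalDist X P s t := by
  have h : eLpNorm (X r - X t) 2 P ≤ eLpNorm (X s - X r) 2 P + eLpNorm (X s - X t) 2 P := by
    have h1 : X r - X t = (X s - X t) - (X s - X r) := by abel
    rw [h1, add_comm]
    exact eLpNorm_sub_le (hX.hasGaussianLaw_sub s t).memLp_two.1
      (hX.hasGaussianLaw_sub s r).memLp_two.1 (by norm_num)
  rw [hX.eLpNorm_sub, hX.eLpNorm_sub, hX.eLpNorm_sub,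
    ← ENNReal.ofReal_add (canonicalDist_nonneg _ _) (canonicalDist_nonneg _ _)] at h
  exact (ENNReal.ofReal_le_ofReal_iff
    (add_nonneg (canonicalDist_nonneg _ _) (canonicalDist_nonneg _ _))).1 h

lemma integral_abs_sub_le (hX : IsContinuousCenteredGaussian X P) (s t : I) :
    ∫ ω, |(X s - X t) ω| ∂P ≤ canonicalDist X P s t := by
  rw [(hX.hasGaussianLaw_sub s t).integral_abs (hX.integral_sub_eq_zero s t)]
  refine Real.sqrt_le_sqrt ?_
  rw [div_le_iff₀ Real.pi_pos]
  nlinarith [variance_nonneg (X s - X t) P, Real.pi_gt_three]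

/-- The excess of a normalized chaining link over the threshold. -/
noncomputable def linkExcess (X : I → Ω → ℝ) (P : Measure Ω) (n : ℕ) (p q : I) (ω : Ω) : ℝ :=
  max ((X p - X q) ω / (canonicalDist X P p q * Real.sqrt 2 ^ n) - chainingThreshold) 0

/-- Bounds a link by its weight times threshold plus excess. Only almost surely, because at zero
canonical distance the normalized link is meaningless and the increment vanishes merely off a null
set. -/
lemma ae_sub_le_linkExcess (hX : IsContinuousCenteredGaussian X P) (n : ℕ) (p q : I) :
    ∀ᵐ ω ∂P, X p ω - X q ω ≤
      canonicalDist X P p q * Real.sqrt 2 ^ n * (chainingThreshold + linkExcess X P n p q ω) := by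
  have hP := hX.gaussian.isProbabilityMeasure
  have hL := (hX.hasGaussianLaw_sub p q).memLp_two
  rcases (canonicalDist_nonneg (X := X) (P := P) p q).eq_or_lt with h | h
  · have hv : Var[X p - X q; P] = 0 := by
      rwa [canonicalDist, eq_comm, Real.sqrt_eq_zero (variance_nonneg _ _)] at h
    filter_upwards [ae_eq_integral_of_variance_eq_zero hL hv] with ω hω
    rw [hX.integral_sub_eq_zero] at hω
    rw [← h]
    simpa using hω.le
  · refine Filter.Eventually.of_forall fun ω => ?_
    have hm : 0 < canonicalDist X P p q * Real.sqrt 2 ^ n := by positivity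
    have h1 : (X p - X q) ω / (canonicalDist X P p q * Real.sqrt 2 ^ n) ≤
        chainingThreshold + linkExcess X P n p q ω := by
      have := le_max_left
        ((X p - X q) ω / (canonicalDist X P p q * Real.sqrt 2 ^ n) - chainingThreshold) 0
      unfold linkExcess
      linarith
    rw [div_le_iff₀' hm] at h1
    exact h1

lemma integrable_linkExcess (hX : IsContinuousCenteredGaussian X P) (n : ℕ) (p q : I) :
    Integrable (linkExcess X P n p q) P := by
  have hP := hX.gaussian.isProbabilityMeasure
  exact (((hX.hasGaussianLaw_sub p q).integrable.div_const _).sub (integrable_const _)).pos_part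

/-- For m = √2^(n+1) and u² = 3 log 2 one has (mu)²/2 = 3 · 2^n · log 2, so the Gaussian factor is
exactly 2^(-3·2^n); the denominator (mu)² m contributes the powers of 2√2. -/
lemma integral_linkExcess_le (hX : IsContinuousCenteredGaussian X P) (n : ℕ) (p q : I) :
    ∫ ω, linkExcess X P (n + 1) p q ω ∂P ≤
      (Real.sqrt (2 * Real.pi))⁻¹ * (3 * Real.log 2)⁻¹ * (2 ^ (3 * 2 ^ n) : ℝ)⁻¹ *
        (2 * Real.sqrt 2)⁻¹ ^ (n + 1) := by
  have h := (hX.hasGaussianLaw_sub p q).integral_posPart_div_sub_le (hX.integral_sub_eq_zero p q)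
    (m := Real.sqrt 2 ^ (n + 1)) (by positivity) chainingThreshold_pos
  refine h.trans (le_of_eq ?_)
  have hsq : (Real.sqrt 2 ^ (n + 1) * chainingThreshold) ^ 2 = 2 ^ (n + 1) * (3 * Real.log 2) := by
    rw [mul_pow, ← pow_mul, mul_comm (n + 1) 2, pow_mul, Real.sq_sqrt (by norm_num),
      chainingThreshold, Real.sq_sqrt (mul_nonneg (by norm_num) (Real.log_nonneg (by norm_num)))]
  have hexp : Real.exp (-(2 ^ (n + 1) * (3 * Real.log 2)) / 2) = (2 ^ (3 * 2 ^ n) : ℝ)⁻¹ := by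
    have h1 : (2 : ℝ) ^ (3 * 2 ^ n) = Real.exp (Real.log 2 * (3 * 2 ^ n : ℕ)) := by
      rw [← Real.rpow_def_of_pos (by norm_num), Real.rpow_natCast]
    rw [h1, ← Real.exp_neg]
    congr 1
    push_cast
    ring
  have hl := Real.log_pos (x := 2) (by norm_num)
  rw [hsq, hexp, inv_pow, mul_pow, div_eq_mul_inv, mul_inv, mul_inv, mul_inv, mul_inv]
  ring

/-- Total excess of the chaining links between consecutive levels. -/
noncomputable def totalExcess (X : I → Ω → ℝ) (P : Measure Ω) (A : ℕ → Finset I) (N : ℕ) (ω : Ω) :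
    ℝ :=
  ∑ n ∈ Finset.range N, ∑ p ∈ A (n + 1), ∑ q ∈ A n, linkExcess X P (n + 1) p q ω

lemma totalExcess_nonneg (A : ℕ → Finset I) (N : ℕ) (ω : Ω) : 0 ≤ totalExcess X P A N ω :=
  Finset.sum_nonneg fun _ _ => Finset.sum_nonneg fun _ _ => Finset.sum_nonneg fun _ _ =>
    le_max_right _ _

lemma integrable_totalExcess (hX : IsContinuousCenteredGaussian X P) (A : ℕ → Finset I) (N : ℕ) :
    Integrable (totalExcess X P A N) P :=
  integrable_finsetSum _ fun n _ => integrable_finsetSum _ fun p _ =>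
    integrable_finsetSum _ fun q _ => hX.integrable_linkExcess (n + 1) p q

/-- There are at most 2^(2^(n+1)) · 2^(2^n) = 2^(3·2^n) links between levels n and n+1, which
cancels the Gaussian factor of each link. What remains is the geometric series Σ_(n≥1) (2√2)^(-n) =
1/(2√2 - 1). -/
lemma integral_totalExcess_le (hX : IsContinuousCenteredGaussian X P) {A : ℕ → Finset I}
    (h0 : (A 0).card = 1) (hA : ∀ n, 1 ≤ n → (A n).card ≤ 2 ^ 2 ^ n) (N : ℕ) :
    ∫ ω, totalExcess X P A N ω ∂P ≤ chainingExcess := by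
  have hr0 : 0 < 2 * Real.sqrt 2 - 1 := by linarith [one_lt_two_mul_sqrt_two]
  have hl := Real.log_pos (x := 2) (by norm_num)
  set r : ℝ := (2 * Real.sqrt 2)⁻¹ with hr
  have hr1 : r < 1 := inv_lt_one_of_one_lt₀ one_lt_two_mul_sqrt_two
  have hrpos : 0 < r := by positivity
  set c : ℝ := (Real.sqrt (2 * Real.pi))⁻¹ * (3 * Real.log 2)⁻¹ with hc
  have hc0 : 0 < c := by positivity
  have hcard : ∀ n, (A n).card ≤ 2 ^ 2 ^ n := fun n => by
    rcases Nat.eq_zero_or_pos n with rfl | hn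
    · simp [h0]
    · exact hA n hn
  have hterm : ∀ n, ∫ ω, ∑ p ∈ A (n + 1), ∑ q ∈ A n, linkExcess X P (n + 1) p q ω ∂P ≤
      c * r ^ (n + 1) := by
    intro n
    rw [integral_finsetSum _ fun p _ =>
      integrable_finsetSum _ fun q _ => hX.integrable_linkExcess (n + 1) p q]
    calc ∑ p ∈ A (n + 1), ∫ ω, ∑ q ∈ A n, linkExcess X P (n + 1) p q ω ∂P
        ≤ ∑ p ∈ A (n + 1), ∑ q ∈ A n, c * (2 ^ (3 * 2 ^ n) : ℝ)⁻¹ * r ^ (n + 1) := by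
          refine Finset.sum_le_sum fun p _ => ?_
          rw [integral_finsetSum _ fun q _ => hX.integrable_linkExcess (n + 1) p q]
          exact Finset.sum_le_sum fun q _ => hX.integral_linkExcess_le n p q
      _ = ((A (n + 1)).card * (A n).card) * (c * (2 ^ (3 * 2 ^ n) : ℝ)⁻¹ * r ^ (n + 1)) := by
          simp only [Finset.sum_const, nsmul_eq_mul]
          ring
      _ ≤ (2 ^ 2 ^ (n + 1) * 2 ^ 2 ^ n) * (c * (2 ^ (3 * 2 ^ n) : ℝ)⁻¹ * r ^ (n + 1)) := by
          gcongr
          · exact_mod_cast hcard (n + 1)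
          · exact_mod_cast hcard n
      _ = c * r ^ (n + 1) := by
          rw [← pow_add, show 2 ^ (n + 1) + 2 ^ n = 3 * 2 ^ n by ring]
          field_simp
  have hgeom : HasSum (fun n : ℕ => c * r ^ (n + 1)) (c * (2 * Real.sqrt 2 - 1)⁻¹) := by
    have h1 := ((hasSum_geometric_of_lt_one hrpos.le hr1).mul_left (c * r))
    have h2 : c * r * (1 - r)⁻¹ = c * (2 * Real.sqrt 2 - 1)⁻¹ := by
      rw [mul_assoc, hr, ← mul_inv, mul_sub, mul_one, mul_inv_cancel₀ (by positivity)]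
    rw [h2] at h1
    refine h1.congr_fun fun n => ?_
    ring
  unfold totalExcess
  rw [integral_finsetSum _ fun n _ => integrable_finsetSum _ fun p _ =>
    integrable_finsetSum _ fun q _ => hX.integrable_linkExcess (n + 1) p q]
  exact (Finset.sum_le_sum fun n _ => hterm n).trans
    (sum_le_hasSum _ (fun n _ => by positivity) hgeom)

/-- The chaining bound for finitely many points, up to the error of the last approximation. -/
lemma integral_iSup_le_chaining (hX : IsContinuousCenteredGaussian X P) {A : ℕ → Finset I}
    (h0 : (A 0).card = 1) (hA : ∀ n, 1 ≤ n → (A n).card ≤ 2 ^ 2 ^ n) {m : ℕ}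
    (f : Fin (m + 1) → I) (π : ℕ → I → I) (hπ : ∀ n i, π n (f i) ∈ A n) {s : ℝ} (N : ℕ)
    (hs : ∀ i, ∑ n ∈ Finset.range (N + 1),
      Real.sqrt 2 ^ n * canonicalDist X P (f i) (π n (f i)) ≤ s) :
    ∫ ω, ⨆ i, X (f i) ω ∂P ≤
      chainingConstant * s + ∑ i, canonicalDist X P (f i) (π N (f i)) := by
  have hP := hX.gaussian.isProbabilityMeasure
  obtain ⟨t₀, ht₀⟩ := Finset.card_eq_one.1 h0
  -- All chains start at the single point of `A 0`, whose variable has mean zero and so drops out of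
  -- the expectation.
  have hroot : ∀ i, π 0 (f i) = t₀ := fun i => by simpa [ht₀] using hπ 0 i
  have hs0 : 0 ≤ s := (Finset.sum_nonneg fun n _ =>
    mul_nonneg (by positivity) (canonicalDist_nonneg _ _)).trans (hs 0)
  have hlinks : ∀ᵐ ω ∂P, ∀ i, ∀ n, X (π (n + 1) (f i)) ω - X (π n (f i)) ω ≤
      canonicalDist X P (π (n + 1) (f i)) (π n (f i)) * Real.sqrt 2 ^ (n + 1) *
        (chainingThreshold + linkExcess X P (n + 1) (π (n + 1) (f i)) (π n (f i)) ω) := by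
    rw [ae_all_iff]; intro i
    rw [ae_all_iff]; intro n
    exact hX.ae_sub_le_linkExcess _ _ _
  have hexcess : ∀ ω i, ∀ n ∈ Finset.range N,
      linkExcess X P (n + 1) (π (n + 1) (f i)) (π n (f i)) ω ≤ totalExcess X P A N ω := by
    intro ω i n hn
    have hnn : ∀ n p q, 0 ≤ linkExcess X P n p q ω := fun n p q => le_max_right _ _
    refine le_trans ?_ (Finset.single_le_sum (f := fun n => ∑ p ∈ A (n + 1), ∑ q ∈ A n,
      linkExcess X P (n + 1) p q ω)
      (fun n _ => Finset.sum_nonneg fun p _ => Finset.sum_nonneg fun q _ => hnn _ _ _) hn)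
    refine le_trans ?_ (Finset.single_le_sum (f := fun p => ∑ q ∈ A n,
      linkExcess X P (n + 1) p q ω)
      (fun p _ => Finset.sum_nonneg fun q _ => hnn _ _ _) (hπ (n + 1) i))
    exact Finset.single_le_sum (f := fun q => linkExcess X P (n + 1) (π (n + 1) (f i)) q ω)
      (fun q _ => hnn _ _ _) (hπ n i)
  -- The triangle inequality through t splits each link in two. The part ending in level n carries
  -- the weight √2^(n+1), one factor √2 too many, whence 1 + √2.
  have hweights : ∀ i, ∑ n ∈ Finset.range N,
      canonicalDist X P (π (n + 1) (f i)) (π n (f i)) * Real.sqrt 2 ^ (n + 1) ≤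
        (1 + Real.sqrt 2) * s := by
    intro i
    have h1 : ∑ n ∈ Finset.range N,
        Real.sqrt 2 ^ (n + 1) * canonicalDist X P (f i) (π (n + 1) (f i)) ≤ s := by
      refine le_trans ?_ (hs i)
      rw [Finset.sum_range_succ']
      exact le_add_of_nonneg_right (mul_nonneg (by positivity) (canonicalDist_nonneg _ _))
    have h2 : ∑ n ∈ Finset.range N,
        Real.sqrt 2 ^ n * canonicalDist X P (f i) (π n (f i)) ≤ s := by
      refine le_trans ?_ (hs i)
      rw [Finset.sum_range_succ]
      exact le_add_of_nonneg_right (mul_nonneg (by positivity) (canonicalDist_nonneg _ _))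
    calc ∑ n ∈ Finset.range N,
          canonicalDist X P (π (n + 1) (f i)) (π n (f i)) * Real.sqrt 2 ^ (n + 1)
        ≤ ∑ n ∈ Finset.range N,
          (Real.sqrt 2 ^ (n + 1) * canonicalDist X P (f i) (π (n + 1) (f i)) +
            Real.sqrt 2 * (Real.sqrt 2 ^ n * canonicalDist X P (f i) (π n (f i)))) := by
          refine Finset.sum_le_sum fun n _ => ?_
          have := hX.canonicalDist_triangle (π (n + 1) (f i)) (f i) (π n (f i))
          calc _ ≤ (canonicalDist X P (f i) (π (n + 1) (f i)) +
                canonicalDist X P (f i) (π n (f i))) * Real.sqrt 2 ^ (n + 1) := by gcongr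
            _ = _ := by ring
      _ ≤ s + Real.sqrt 2 * s := by
          rw [Finset.sum_add_distrib, ← Finset.mul_sum]
          gcongr
      _ = _ := by ring
  -- Replacing every link's excess by the total over all links makes the bound uniform in the point.
  -- The last approximation error is summed crudely over the points, which is harmless since N tends
  -- to infinity with the points fixed.
  let bound : Ω → ℝ := fun ω => X t₀ ω +
    (1 + Real.sqrt 2) * s * (chainingThreshold + totalExcess X P A N ω) +
      ∑ i, |(X (f i) - X (π N (f i))) ω|
  have hI0 : Integrable (fun ω =>
      (1 + Real.sqrt 2) * s * (chainingThreshold + totalExcess X P A N ω)) P :=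
    ((integrable_const chainingThreshold).add (hX.integrable_totalExcess A N)).const_mul _
  have hI1 : Integrable (fun ω => X t₀ ω +
      (1 + Real.sqrt 2) * s * (chainingThreshold + totalExcess X P A N ω)) P :=
    (hX.integrable_eval t₀).add hI0
  have hI2 : ∀ i, Integrable (fun ω => |(X (f i) - X (π N (f i))) ω|) P := fun i =>
    (hX.hasGaussianLaw_sub _ _).integrable.abs
  have hbound : ∀ᵐ ω ∂P, ⨆ i, X (f i) ω ≤ bound ω := by
    filter_upwards [hlinks] with ω hω
    refine ciSup_le fun i => ?_
    have hnonneg : 0 ≤ chainingThreshold + totalExcess X P A N ω :=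
      add_nonneg chainingThreshold_pos.le (totalExcess_nonneg A N ω)
    have h1 : X (π N (f i)) ω - X t₀ ω ≤
        (1 + Real.sqrt 2) * s * (chainingThreshold + totalExcess X P A N ω) := by
      rw [← hroot i, ← Finset.sum_range_sub (fun n => X (π n (f i)) ω) N]
      calc ∑ n ∈ Finset.range N, (X (π (n + 1) (f i)) ω - X (π n (f i)) ω)
          ≤ ∑ n ∈ Finset.range N,
            canonicalDist X P (π (n + 1) (f i)) (π n (f i)) * Real.sqrt 2 ^ (n + 1) *
              (chainingThreshold + totalExcess X P A N ω) := by
            refine Finset.sum_le_sum fun n hn => (hω i n).trans ?_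
            refine mul_le_mul_of_nonneg_left ?_
              (mul_nonneg (canonicalDist_nonneg _ _) (by positivity))
            linarith [hexcess ω i n hn]
        _ ≤ _ := by
            rw [← Finset.sum_mul]
            exact mul_le_mul_of_nonneg_right (hweights i) hnonneg
    have h2 : X (f i) ω - X (π N (f i)) ω ≤ ∑ i, |(X (f i) - X (π N (f i))) ω| :=
      (le_abs_self _).trans (Finset.single_le_sum
        (f := fun i => |(X (f i) - X (π N (f i))) ω|) (fun _ _ => abs_nonneg _)
        (Finset.mem_univ i))
    simp only [bound]
    linarith
  calc ∫ ω, ⨆ i, X (f i) ω ∂P ≤ ∫ ω, bound ω ∂P :=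
        integral_mono_ae (hX.integrable_iSup_countable f)
          (hI1.add (integrable_finsetSum _ fun i _ => hI2 i)) hbound
    _ = (1 + Real.sqrt 2) * s * (chainingThreshold + ∫ ω, totalExcess X P A N ω ∂P) +
          ∑ i, ∫ ω, |(X (f i) - X (π N (f i))) ω| ∂P := by
        simp only [bound]
        rw [integral_add hI1 (integrable_finsetSum _ fun i _ => hI2 i),
          integral_finsetSum _ fun i _ => hI2 i,
          integral_add (hX.integrable_eval t₀) hI0,
          integral_const_mul, integral_add (integrable_const _) (hX.integrable_totalExcess A N),
          hX.centered, integral_const]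
        simp
    _ ≤ chainingConstant * s + ∑ i, canonicalDist X P (f i) (π N (f i)) := by
        refine add_le_add ?_ (Finset.sum_le_sum fun i _ => hX.integral_abs_sub_le _ _)
        have := hX.integral_totalExcess_le h0 hA N
        calc (1 + Real.sqrt 2) * s * (chainingThreshold + ∫ ω, totalExcess X P A N ω ∂P)
            ≤ (1 + Real.sqrt 2) * s * (chainingThreshold + chainingExcess) := by gcongr
          _ = _ := by unfold chainingConstant; ring

end IsContinuousCenteredGaussian

lemma two_rpow_half_eq (n : ℕ) :
    (2 : ℝ≥0∞) ^ ((n : ℝ) / 2) = ENNReal.ofReal (Real.sqrt 2 ^ n) := by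
  rw [Real.sqrt_eq_rpow, ← Real.rpow_natCast, ← Real.rpow_mul (by norm_num),
    ← ENNReal.ofReal_rpow_of_pos (by norm_num)]
  congr 1
  · simp
  · ring

/-- Chains run through nearest points of `A n`. When the right-hand side S is finite, each single
term is at most S, so the distance from t to its N-th approximation is at most S √2^(-N). For
finitely many points the leftover error thus vanishes as N grows. -/
theorem genericChainingBound_chainingConstant : GenericChainingBound.{u} chainingConstant := by
  intro Ω _ P _ X hX T A hmono hAT h0 hA
  obtain ⟨t₀, ht₀⟩ := Finset.card_eq_one.1 h0
  have hAne : ∀ n, (A n).Nonempty := fun n =>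
    ⟨t₀, hmono (Nat.zero_le n) (by simp [ht₀])⟩
  have hT : Nonempty T := ⟨⟨t₀, hAT 0 (by simp [ht₀])⟩⟩
  refine ⟨hX.integrable_iSup T, ?_⟩
  set S : ℝ≥0∞ := ⨆ t ∈ T, ∑' n : ℕ, (2 : ℝ≥0∞) ^ ((n : ℝ) / 2) *
    ⨅ s ∈ A n, eLpNorm (X t - X s) 2 P with hS
  rcases eq_or_ne S ∞ with hStop | hStop
  · rw [hStop, ENNReal.mul_top (by simpa using chainingConstant_pos)]
    exact le_top
  have hmin : ∀ n (t : I), ∃ s ∈ A n, ∀ s' ∈ A n, canonicalDist X P t s ≤ canonicalDist X P t s' :=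
    fun n t => Finset.exists_min_image (A n) (canonicalDist X P t) (hAne n)
  choose π hπ hπmin using hmin
  have hsum : ∀ t ∈ T, ∀ N, ∑ n ∈ Finset.range N,
      Real.sqrt 2 ^ n * canonicalDist X P t (π n t) ≤ S.toReal := by
    intro t ht N
    have hnn : ∀ n, 0 ≤ Real.sqrt 2 ^ n * canonicalDist X P t (π n t) := fun n =>
      mul_nonneg (by positivity) (IsContinuousCenteredGaussian.canonicalDist_nonneg _ _)
    rw [← ENNReal.ofReal_le_iff_le_toReal hStop, ENNReal.ofReal_sum_of_nonneg fun n _ => hnn n]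
    calc ∑ n ∈ Finset.range N, ENNReal.ofReal (Real.sqrt 2 ^ n * canonicalDist X P t (π n t))
        ≤ ∑ n ∈ Finset.range N, (2 : ℝ≥0∞) ^ ((n : ℝ) / 2) *
            ⨅ s ∈ A n, eLpNorm (X t - X s) 2 P := by
          refine Finset.sum_le_sum fun n _ => ?_
          rw [ENNReal.ofReal_mul (by positivity), two_rpow_half_eq]
          gcongr
          refine le_iInf₂ fun s hs => ?_
          rw [hX.eLpNorm_sub]
          exact ENNReal.ofReal_le_ofReal (hπmin n t s hs)
      _ ≤ ∑' n : ℕ, (2 : ℝ≥0∞) ^ ((n : ℝ) / 2) * ⨅ s ∈ A n, eLpNorm (X t - X s) 2 P :=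
          ENNReal.sum_le_tsum _
      _ ≤ S := le_iSup₂ (f := fun t (_ : t ∈ T) => ∑' n : ℕ, (2 : ℝ≥0∞) ^ ((n : ℝ) / 2) *
            ⨅ s ∈ A n, eLpNorm (X t - X s) 2 P) t ht
  have hmain : ∫ ω, ⨆ t : T, X t ω ∂P ≤ chainingConstant * S.toReal := by
    refine hX.integral_iSup_le T fun m f => ?_
    have hlast : ∀ N i, canonicalDist X P (f i) (π N (f i)) ≤ S.toReal * (Real.sqrt 2)⁻¹ ^ N := by
      intro N i
      have h1 := hsum (f i) (f i).2 (N + 1)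
      rw [Finset.sum_range_succ] at h1
      have h2 : Real.sqrt 2 ^ N * canonicalDist X P (f i) (π N (f i)) ≤ S.toReal :=
        le_trans (le_add_of_nonneg_left (Finset.sum_nonneg fun n _ =>
          mul_nonneg (by positivity) (IsContinuousCenteredGaussian.canonicalDist_nonneg _ _))) h1
      rw [inv_pow, ← div_eq_mul_inv, le_div_iff₀' (by positivity)]
      exact h2
    have hN : ∀ N, ∫ ω, ⨆ i, X (f i) ω ∂P ≤ chainingConstant * S.toReal +
        ∑ _i : Fin (m + 1), S.toReal * (Real.sqrt 2)⁻¹ ^ N := by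
      intro N
      refine (hX.integral_iSup_le_chaining h0 hA (fun i => (f i : I)) π (fun n i => hπ n _) N
        (fun i => hsum (f i) (f i).2 (N + 1))).trans ?_
      gcongr with i
      exact hlast N i
    refine ge_of_tendsto' (x := Filter.atTop) (f := fun N : ℕ => chainingConstant * S.toReal +
        ∑ _i : Fin (m + 1), S.toReal * (Real.sqrt 2)⁻¹ ^ N) ?_ hN
    have hlt : (Real.sqrt 2)⁻¹ < 1 := by
      refine inv_lt_one_of_one_lt₀ ?_
      rw [Real.lt_sqrt (by norm_num)]; norm_num
    have h1 := tendsto_pow_atTop_nhds_zero_of_lt_one (by positivity) hlt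
    have h2 := tendsto_const_nhds.add (tendsto_finsetSum (Finset.univ : Finset (Fin (m + 1)))
      fun _ _ => h1.const_mul S.toReal) (f := fun _ => chainingConstant * S.toReal)
    simpa using h2
  calc ENNReal.ofReal (∫ ω, ⨆ t : T, X t ω ∂P)
      ≤ ENNReal.ofReal (chainingConstant * S.toReal) := ENNReal.ofReal_le_ofReal hmain
    _ = ENNReal.ofReal chainingConstant * S := by
        rw [ENNReal.ofReal_mul chainingConstant_pos.le, ENNReal.ofReal_toReal hStop]

end GenericChaining

/-! ### Hölder increments: dyadic nets and the erfc bound -/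

section UpperBound

lemma integrable_exp_neg_sq : Integrable fun t : ℝ => Real.exp (-t ^ 2) := by
  simpa using integrable_exp_neg_mul_sq (b := 1) one_pos

lemma erfc_le_one {x : ℝ} (hx : 0 ≤ x) : erfc x ≤ 1 := by
  have h1 : ∫ t in Set.Ioi x, Real.exp (-t ^ 2) ≤ ∫ t in Set.Ioi 0, Real.exp (-t ^ 2) :=
    setIntegral_mono_set integrable_exp_neg_sq.integrableOn
      (Filter.Eventually.of_forall fun t => (Real.exp_pos _).le)
      (Set.Ioi_subset_Ioi hx).eventuallyLE
  have h2 : ∫ t in Set.Ioi (0 : ℝ), Real.exp (-t ^ 2) = Real.sqrt Real.pi / 2 := by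
    simpa using integral_gaussian_Ioi 1
  have hpi : 0 < Real.sqrt Real.pi := Real.sqrt_pos.2 Real.pi_pos
  unfold erfc
  calc 2 / Real.sqrt Real.pi * ∫ t in Set.Ioi x, Real.exp (-t ^ 2)
      ≤ 2 / Real.sqrt Real.pi * (Real.sqrt Real.pi / 2) := by
        rw [← h2]; gcongr
    _ = 1 := by field_simp

/-- Comparison of a lacunary sum with the tail of a Gaussian integral. -/
lemma sum_sqrt_two_pow_mul_exp_le {H : ℝ} (hH : 0 < H) (N : ℕ) :
    ∑ n ∈ Finset.range N, Real.sqrt 2 ^ n * Real.exp (-(H * Real.log 2 * 2 ^ n)) ≤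
      Real.sqrt (2 * Real.pi / (H * Real.log 2 ^ 3)) * erfc (Real.sqrt (Real.log 2 / 2 * H)) := by
  have hl : 0 < Real.log 2 := Real.log_pos (by norm_num)
  set b := Real.sqrt (Real.log 2 / 2 * H) with hb
  have hb0 : 0 < b := Real.sqrt_pos.2 (by positivity)
  have hb2 : b ^ 2 = Real.log 2 / 2 * H := Real.sq_sqrt (by positivity)
  have hpi : 0 < Real.sqrt Real.pi := Real.sqrt_pos.2 Real.pi_pos
  have hconst : Real.sqrt (2 * Real.pi / (H * Real.log 2 ^ 3)) * erfc b =
      2 / (Real.log 2 * b) * ∫ t in Set.Ioi b, Real.exp (-t ^ 2) := by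
    have h1 : Real.sqrt (2 * Real.pi / (H * Real.log 2 ^ 3)) =
        Real.sqrt Real.pi / (Real.log 2 * b) := by
      rw [Real.sqrt_eq_iff_mul_self_eq (by positivity) (by positivity), div_mul_div_comm,
        Real.mul_self_sqrt Real.pi_pos.le,
        show Real.log 2 * b * (Real.log 2 * b) = Real.log 2 ^ 2 * b ^ 2 by ring, hb2]
      field_simp
    rw [h1, erfc]
    field_simp
  have hs : 1.41 < Real.sqrt 2 := by
    rw [Real.lt_sqrt (by norm_num)]; norm_num
  -- With b² = H log 2 / 2, the right endpoint satisfies z(n+1)² = H log 2 · 2^n, so the smallest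
  -- value of exp(-t²) on the n-th interval is precisely the exponential in the n-th term.
  let z : ℕ → ℝ := fun n => b * Real.sqrt 2 ^ n
  have hz : ∀ n, z n ≤ z (n + 1) := fun n => by
    simp only [z, pow_succ]
    have : 0 < b * Real.sqrt 2 ^ n := by positivity
    nlinarith
  have hzmono : Monotone z := monotone_nat_of_le_succ hz
  have hterm : ∀ n, Real.sqrt 2 ^ n * Real.exp (-(H * Real.log 2 * 2 ^ n)) ≤
      2 / (Real.log 2 * b) * ∫ t in z n..z (n + 1), Real.exp (-t ^ 2) := by
    intro n
    have hlow : (z (n + 1) - z n) * Real.exp (-(z (n + 1)) ^ 2) ≤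
        ∫ t in z n..z (n + 1), Real.exp (-t ^ 2) := by
      rw [← smul_eq_mul, ← intervalIntegral.integral_const]
      refine intervalIntegral.integral_mono_on (hz n) (by simp)
        (integrable_exp_neg_sq.intervalIntegrable) fun t ht => ?_
      have h0 : 0 ≤ z n := by positivity
      exact Real.exp_le_exp.2 (neg_le_neg (pow_le_pow_left₀ (h0.trans ht.1) ht.2 2))
    have hsq : z (n + 1) ^ 2 = H * Real.log 2 * 2 ^ n := by
      simp only [z]
      rw [mul_pow, ← pow_mul, mul_comm (n + 1) 2, pow_mul,
        Real.sq_sqrt (show (0 : ℝ) ≤ 2 by norm_num), hb2]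
      ring
    rw [hsq] at hlow
    have hdiff : z (n + 1) - z n = b * Real.sqrt 2 ^ n * (Real.sqrt 2 - 1) := by
      simp only [z]; ring
    rw [hdiff] at hlow
    -- The interval has length b √2^n (√2 - 1); the constant 2/log 2 is admissible because 2(√2 - 1)
    -- > 0.82 > log 2.
    have hge : 1 ≤ 2 / Real.log 2 * (Real.sqrt 2 - 1) := by
      rw [div_mul_eq_mul_div, one_le_div hl]
      linarith [Real.log_two_lt_d9]
    calc Real.sqrt 2 ^ n * Real.exp (-(H * Real.log 2 * 2 ^ n))
        = 1 * (Real.sqrt 2 ^ n * Real.exp (-(H * Real.log 2 * 2 ^ n))) := (one_mul _).symm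
      _ ≤ 2 / Real.log 2 * (Real.sqrt 2 - 1) *
            (Real.sqrt 2 ^ n * Real.exp (-(H * Real.log 2 * 2 ^ n))) := by gcongr
      _ = 2 / (Real.log 2 * b) * (b * Real.sqrt 2 ^ n * (Real.sqrt 2 - 1) *
            Real.exp (-(H * Real.log 2 * 2 ^ n))) := by field_simp
      _ ≤ _ := by gcongr
  rw [hconst]
  calc _ ≤ ∑ n ∈ Finset.range N,
        2 / (Real.log 2 * b) * ∫ t in z n..z (n + 1), Real.exp (-t ^ 2) :=
        Finset.sum_le_sum fun n _ => hterm n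
    _ = 2 / (Real.log 2 * b) * ∫ t in z 0..z N, Real.exp (-t ^ 2) := by
        rw [← Finset.mul_sum, intervalIntegral.sum_integral_adjacent_intervals fun n _ =>
          integrable_exp_neg_sq.intervalIntegrable]
    _ ≤ _ := by
        gcongr
        rw [intervalIntegral.integral_of_le (hzmono (Nat.zero_le N))]
        refine setIntegral_mono_set integrable_exp_neg_sq.integrableOn
          (Filter.Eventually.of_forall fun t => (Real.exp_pos _).le) ?_
        refine Filter.Eventually.of_forall fun t ht => ?_
        have : z 0 = b := by simp [z]
        rw [← this]
        exact ht.1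

/-- The point of the unit interval closest to `k / m`. -/
noncomputable def gridPoint (m k : ℕ) : I := Set.projIcc 0 1 zero_le_one ((k : ℝ) / m)

lemma coe_gridPoint {m k : ℕ} (hk : k ≤ m) : (gridPoint m k : ℝ) = k / m := by
  have h : (k : ℝ) / m ∈ Set.Icc (0 : ℝ) 1 :=
    ⟨by positivity, div_le_one_of_le₀ (by exact_mod_cast hk) (by positivity)⟩
  rw [gridPoint, Set.projIcc_of_mem _ h]

/-- Doubly exponential dyadic grids in the unit interval, starting from the midpoint. -/
noncomputable def dyadicGrid : ℕ → Finset I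
  | 0 => {gridPoint 2 1}
  | n + 1 => (Finset.Icc 1 (2 ^ 2 ^ (n + 1))).image (gridPoint (2 ^ 2 ^ (n + 1)))

/-- The numerators start at 1, so that a grid of mesh 1/m has only m points; k/m is found again in
the next grid, of mesh 1/m², as km/m². The initial midpoint reappears as 2/4. -/
lemma dyadicGrid_monotone : Monotone dyadicGrid := by
  refine monotone_nat_of_le_succ fun n => ?_
  rcases n with _ | n
  · intro x hx
    rw [dyadicGrid, Finset.mem_singleton] at hx
    subst hx
    refine Finset.mem_image.2 ⟨2, by simp, Subtype.ext ?_⟩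
    rw [coe_gridPoint (by norm_num), coe_gridPoint (by norm_num)]
    norm_num
  · intro x hx
    obtain ⟨k, hk, rfl⟩ := Finset.mem_image.1 hx
    rw [Finset.mem_Icc] at hk
    have hpos : 0 < 2 ^ 2 ^ (n + 1) := by positivity
    have hsq : 2 ^ 2 ^ (n + 2) = 2 ^ 2 ^ (n + 1) * 2 ^ 2 ^ (n + 1) := by
      rw [← pow_add]; congr 1; ring
    have hle : k * 2 ^ 2 ^ (n + 1) ≤ 2 ^ 2 ^ (n + 2) := by
      rw [hsq]; exact Nat.mul_le_mul_right _ hk.2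
    refine Finset.mem_image.2 ⟨k * 2 ^ 2 ^ (n + 1),
      Finset.mem_Icc.2 ⟨Nat.mul_pos hk.1 hpos, hle⟩, Subtype.ext ?_⟩
    rw [coe_gridPoint hle, coe_gridPoint hk.2, hsq]
    push_cast
    field_simp

/-- The midpoint is within 1/2 of everything; at later levels t is rounded up to the grid, and t = 0
goes to the first grid point because 0 is excluded. -/
lemma exists_mem_dyadicGrid (n : ℕ) (t : I) :
    ∃ s ∈ dyadicGrid n, |(t : ℝ) - s| ≤ ((2 : ℝ) ^ 2 ^ n)⁻¹ := by
  rcases n with _ | n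
  · refine ⟨gridPoint 2 1, by simp [dyadicGrid], ?_⟩
    rw [coe_gridPoint (by norm_num), abs_le]
    have h0 := t.2.1
    have h1 := t.2.2
    norm_num
    constructor <;> linarith
  · set m := 2 ^ 2 ^ (n + 1) with hm
    have hm0 : 0 < (m : ℝ) := by positivity
    have hceil : ⌈(t : ℝ) * m⌉₊ ≤ m := by
      rw [Nat.ceil_le]
      exact mul_le_of_le_one_left hm0.le t.2.2
    have hk : max 1 ⌈(t : ℝ) * m⌉₊ ≤ m := max_le (Nat.one_le_two_pow) hceil
    refine ⟨gridPoint m (max 1 ⌈(t : ℝ) * m⌉₊),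
      Finset.mem_image.2 ⟨_, Finset.mem_Icc.2 ⟨le_max_left _ _, hk⟩, rfl⟩, ?_⟩
    rw [coe_gridPoint hk, show ((2 : ℝ) ^ 2 ^ (n + 1)) = m by simp [hm]]
    have h1 : (t : ℝ) * m ≤ (max 1 ⌈(t : ℝ) * m⌉₊ : ℕ) :=
      (Nat.le_ceil _).trans (by exact_mod_cast le_max_right _ _)
    have h2 : ((max 1 ⌈(t : ℝ) * m⌉₊ : ℕ) : ℝ) ≤ t * m + 1 := by
      have h3 := (Nat.ceil_lt_add_one (mul_nonneg t.2.1 hm0.le)).le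
      have h4 : (0 : ℝ) ≤ t * m := mul_nonneg t.2.1 hm0.le
      rw [Nat.cast_max, Nat.cast_one]
      exact max_le (by linarith) h3
    have h5 : (t : ℝ) - (max 1 ⌈(t : ℝ) * m⌉₊ : ℕ) / m =
        (t * m - (max 1 ⌈(t : ℝ) * m⌉₊ : ℕ)) / m := by field_simp
    rw [h5, abs_div, abs_of_pos hm0, div_le_iff₀ hm0, inv_mul_cancel₀ hm0.ne', abs_le]
    constructor <;> linarith

lemma card_dyadicGrid_le (n : ℕ) (hn : 1 ≤ n) : (dyadicGrid n).card ≤ 2 ^ 2 ^ n := by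
  obtain ⟨m, rfl⟩ : ∃ m, n = m + 1 := ⟨n - 1, by omega⟩
  exact Finset.card_image_le.trans (by simp)

lemma chainingConstant_mul_lt {C H : ℝ} (hC : 0 < C) (hH : 0 < H) :
    chainingConstant * C * Real.sqrt (2 * Real.pi / (H * Real.log 2 ^ 3)) *
      erfc (Real.sqrt (Real.log 2 / 2 * H)) < 16.3 * C / Real.sqrt H := by
  have hl : 0 < Real.log 2 := Real.log_pos (by norm_num)
  have hH' : 0 < Real.sqrt H := Real.sqrt_pos.2 hH
  have hsplit : Real.sqrt (2 * Real.pi / (H * Real.log 2 ^ 3)) =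
      Real.sqrt (2 * Real.pi / Real.log 2 ^ 3) / Real.sqrt H := by
    rw [← Real.sqrt_div (by positivity), div_div, mul_comm H]
  have hnum : Real.sqrt (2 * Real.pi / Real.log 2 ^ 3) < 4.346 := by
    rw [Real.sqrt_lt' (by norm_num), div_lt_iff₀ (by positivity)]
    have h1 : (0.693147 : ℝ) ^ 3 ≤ Real.log 2 ^ 3 :=
      pow_le_pow_left₀ (by norm_num) (by linarith [Real.log_two_gt_d9]) 3
    have h2 := Real.pi_lt_d4
    norm_num at h1 ⊢
    linarith
  have hpos := chainingConstant_pos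
  calc chainingConstant * C * Real.sqrt (2 * Real.pi / (H * Real.log 2 ^ 3)) *
        erfc (Real.sqrt (Real.log 2 / 2 * H))
      ≤ chainingConstant * C * Real.sqrt (2 * Real.pi / (H * Real.log 2 ^ 3)) * 1 := by
        gcongr
        exact erfc_le_one (Real.sqrt_nonneg _)
    _ = chainingConstant * Real.sqrt (2 * Real.pi / Real.log 2 ^ 3) * (C / Real.sqrt H) := by
        rw [hsplit]; ring
    _ < 16.3 * (C / Real.sqrt H) := by
        refine mul_lt_mul_of_pos_right ?_ (by positivity)
        -- 3.75 · 4.346 = 16.2975.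
        refine (mul_lt_mul'' chainingConstant_lt hnum hpos.le (Real.sqrt_nonneg _)).trans ?_
        norm_num
    _ = _ := by ring

/-- The n-th grid approximates within 2^(-2^n), hence within C exp(-H log 2 · 2^n) in the canonical
distance, and the weighted sum of these errors is the lacunary sum compared with erfc above. -/
lemma IsContinuousCenteredGaussian.integral_iSup_le_of_holder {Ω : Type u} [MeasurableSpace Ω]
    {P : Measure Ω} [IsProbabilityMeasure P] {X : I → Ω → ℝ}
    (hX : IsContinuousCenteredGaussian X P) {C H : ℝ} (hC : 0 < C) (hH : 0 < H)
    (h : ∀ t s : I, eLpNorm (X t - X s) 2 P ≤ ENNReal.ofReal (C * |(t : ℝ) - s| ^ H)) :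
    ∫ ω, ⨆ t, X t ω ∂P ≤ chainingConstant * C * Real.sqrt (2 * Real.pi / (H * Real.log 2 ^ 3)) *
      erfc (Real.sqrt (Real.log 2 / 2 * H)) := by
  set J := Real.sqrt (2 * Real.pi / (H * Real.log 2 ^ 3)) *
    erfc (Real.sqrt (Real.log 2 / 2 * H)) with hJ
  -- The case of the empty sum.
  have hJ0 : 0 ≤ J := by simpa using sum_sqrt_two_pow_mul_exp_le hH 0
  have hpos := chainingConstant_pos
  have hchain := (genericChainingBound_chainingConstant Ω P X hX Set.univ dyadicGrid
    dyadicGrid_monotone (fun n => Set.subset_univ _) (by simp [dyadicGrid])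
    card_dyadicGrid_le).2
  have hsup : ∀ ω, ⨆ t : (Set.univ : Set I), X t ω = ⨆ t, X t ω := fun ω =>
    (Equiv.Set.univ I).iSup_comp (g := fun t => X t ω)
  simp_rw [hsup] at hchain
  have hS : ⨆ t ∈ (Set.univ : Set I), ∑' n : ℕ, (2 : ℝ≥0∞) ^ ((n : ℝ) / 2) *
      ⨅ s ∈ dyadicGrid n, eLpNorm (X t - X s) 2 P ≤ ENNReal.ofReal (C * J) := by
    refine iSup₂_le fun t _ => ENNReal.tsum_le_of_sum_range_le fun N => ?_
    calc ∑ n ∈ Finset.range N, (2 : ℝ≥0∞) ^ ((n : ℝ) / 2) *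
          ⨅ s ∈ dyadicGrid n, eLpNorm (X t - X s) 2 P
        ≤ ∑ n ∈ Finset.range N, ENNReal.ofReal
            (C * (Real.sqrt 2 ^ n * Real.exp (-(H * Real.log 2 * 2 ^ n)))) := by
          refine Finset.sum_le_sum fun n _ => ?_
          obtain ⟨s, hs, hts⟩ := exists_mem_dyadicGrid n t
          have h1 : |(t : ℝ) - s| ^ H ≤ Real.exp (-(H * Real.log 2 * 2 ^ n)) := by
            refine (Real.rpow_le_rpow (abs_nonneg _) hts hH.le).trans (le_of_eq ?_)
            rw [← Real.rpow_natCast 2, ← Real.rpow_neg (by norm_num),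
              ← Real.rpow_mul (by norm_num), Real.rpow_def_of_pos (by norm_num)]
            congr 1
            push_cast
            ring
          rw [two_rpow_half_eq, mul_left_comm,
            ENNReal.ofReal_mul (p := Real.sqrt 2 ^ n) (by positivity)]
          gcongr
          refine (iInf₂_le s hs).trans ((h t s).trans (ENNReal.ofReal_le_ofReal ?_))
          gcongr
      _ = ENNReal.ofReal (C * ∑ n ∈ Finset.range N,
            Real.sqrt 2 ^ n * Real.exp (-(H * Real.log 2 * 2 ^ n))) := by
          rw [Finset.mul_sum, ENNReal.ofReal_sum_of_nonneg fun n _ => by positivity]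
      _ ≤ ENNReal.ofReal (C * J) := by
          refine ENNReal.ofReal_le_ofReal ?_
          gcongr
          exact sum_sqrt_two_pow_mul_exp_le hH N
  have hfin : ENNReal.ofReal (∫ ω, ⨆ t, X t ω ∂P) ≤
      ENNReal.ofReal (chainingConstant * (C * J)) := by
    refine hchain.trans ?_
    rw [ENNReal.ofReal_mul hpos.le]
    gcongr
  have := (ENNReal.ofReal_le_ofReal_iff (by positivity)).1 hfin
  calc _ ≤ _ := this
    _ = _ := by rw [hJ]; ring

end UpperBound

/-! ### Log-sum-exp and its derivatives -/

section LogSumExp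

variable {ι : Type*} [Fintype ι]

/-- The softmax weights of a vector. -/
noncomputable def softmax (x : ι → ℝ) (i : ι) : ℝ := Real.exp (x i) / ∑ j, Real.exp (x j)

/-- The log-sum-exp of a vector, a smooth approximation of the maximum of its entries. -/
noncomputable def logSumExp (x : ι → ℝ) : ℝ := Real.log (∑ j, Real.exp (x j))

lemma sum_exp_pos [Nonempty ι] (x : ι → ℝ) : 0 < ∑ j, Real.exp (x j) :=
  Finset.sum_pos (fun _ _ => Real.exp_pos _) Finset.univ_nonempty

lemma softmax_nonneg (x : ι → ℝ) (i : ι) : 0 ≤ softmax x i :=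
  div_nonneg (Real.exp_pos _).le (Finset.sum_nonneg fun _ _ => (Real.exp_pos _).le)

lemma sum_softmax [Nonempty ι] (x : ι → ℝ) : ∑ i, softmax x i = 1 := by
  simp only [softmax]
  rw [← Finset.sum_div, div_self (sum_exp_pos x).ne']

lemma softmax_le_one [Nonempty ι] (x : ι → ℝ) (i : ι) : softmax x i ≤ 1 := by
  rw [← sum_softmax x]
  exact Finset.single_le_sum (fun j _ => softmax_nonneg x j) (Finset.mem_univ i)

lemma abs_softmax_le_one [Nonempty ι] (x : ι → ℝ) (i : ι) : |softmax x i| ≤ 1 := by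
  rw [abs_of_nonneg (softmax_nonneg x i)]
  exact softmax_le_one x i

lemma continuous_softmax [Nonempty ι] (i : ι) : Continuous fun x : ι → ℝ => softmax x i := by
  unfold softmax
  exact Continuous.div (by fun_prop) (by fun_prop) fun x => (sum_exp_pos x).ne'

lemma continuous_logSumExp [Nonempty ι] : Continuous (logSumExp : (ι → ℝ) → ℝ) := by
  unfold logSumExp
  exact Continuous.log (by fun_prop) fun x => (sum_exp_pos x).ne'

lemma le_logSumExp [Nonempty ι] (x : ι → ℝ) (i : ι) : x i ≤ logSumExp x := by
  rw [logSumExp, Real.le_log_iff_exp_le (sum_exp_pos x)]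
  exact Finset.single_le_sum (f := fun j => Real.exp (x j)) (fun j _ => (Real.exp_pos _).le)
    (Finset.mem_univ i)

lemma logSumExp_le [Nonempty ι] {x : ι → ℝ} {m : ℝ} (hx : ∀ i, x i ≤ m) :
    logSumExp x ≤ m + Real.log (Fintype.card ι) := by
  have hc : (0 : ℝ) < Fintype.card ι := by exact_mod_cast Fintype.card_pos
  rw [logSumExp, Real.log_le_iff_le_exp (sum_exp_pos x), Real.exp_add, Real.exp_log hc]
  calc ∑ j, Real.exp (x j) ≤ ∑ _j : ι, Real.exp m :=
        Finset.sum_le_sum fun j _ => Real.exp_le_exp.2 (hx j)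
    _ = _ := by simp [mul_comm]

lemma abs_logSumExp_le [Nonempty ι] (x : ι → ℝ) :
    |logSumExp x| ≤ ∑ i, |x i| + Real.log (Fintype.card ι) := by
  have hx : ∀ i, |x i| ≤ ∑ i, |x i| := fun i =>
    Finset.single_le_sum (f := fun i => |x i|) (fun _ _ => abs_nonneg _) (Finset.mem_univ i)
  have hlog : 0 ≤ Real.log (Fintype.card ι) :=
    Real.log_nonneg (by exact_mod_cast Fintype.card_pos)
  obtain ⟨i⟩ := ‹Nonempty ι›
  refine abs_le.2 ⟨?_, logSumExp_le fun i => (le_abs_self _).trans (hx i)⟩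
  have h1 := le_logSumExp x i
  have h2 := neg_abs_le (x i)
  linarith [hx i]

lemma hasDerivAt_logSumExp [Nonempty ι] {x : ℝ → ι → ℝ} {x' : ι → ℝ} {s : ℝ}
    (h : ∀ i, HasDerivAt (fun r => x r i) (x' i) s) :
    HasDerivAt (fun r => logSumExp (x r)) (∑ i, softmax (x s) i * x' i) s := by
  have h1 : HasDerivAt (fun r => ∑ j, Real.exp (x r j)) (∑ j, Real.exp (x s j) * x' j) s :=
    HasDerivAt.fun_sum fun j _ => (h j).exp
  convert! h1.log (sum_exp_pos _).ne' using 1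
  rw [Finset.sum_div]
  exact Finset.sum_congr rfl fun i _ => by simp only [softmax]; ring

lemma hasDerivAt_softmax [Nonempty ι] {x : ℝ → ι → ℝ} {x' : ι → ℝ} {s : ℝ}
    (h : ∀ i, HasDerivAt (fun r => x r i) (x' i) s) (i : ι) :
    HasDerivAt (fun r => softmax (x r) i)
      (softmax (x s) i * (x' i - ∑ j, softmax (x s) j * x' j)) s := by
  have h1 : HasDerivAt (fun r => ∑ j, Real.exp (x r j)) (∑ j, Real.exp (x s j) * x' j) s :=
    HasDerivAt.fun_sum fun j _ => (h j).exp
  convert! (h i).exp.div h1 (sum_exp_pos _).ne' using 1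
  have h2 : ∑ j, softmax (x s) j * x' j =
      (∑ j, Real.exp (x s j) * x' j) / ∑ j, Real.exp (x s j) := by
    rw [Finset.sum_div]
    exact Finset.sum_congr rfl fun i _ => by simp only [softmax]; ring
  rw [h2, softmax]
  have := (sum_exp_pos (x s)).ne'
  field_simp

/-- Symmetrization: twice the sum equals Σ_(i,j) p_i p_j (D_ii + D_jj - 2 D_ij). With D a difference
of covariance matrices the bracket is a difference of squared increments, which is how the
comparison hypothesis enters. -/
lemma sum_mul_diag_sub_nonneg {p : ι → ℝ} (hp : ∀ i, 0 ≤ p i) (hp1 : ∑ i, p i = 1)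
    {D : ι → ι → ℝ} (hD : ∀ i j, 0 ≤ D i i + D j j - 2 * D i j) :
    0 ≤ ∑ i, p i * (D i i - ∑ j, p j * D i j) := by
  have h1 : ∑ i, ∑ j, p i * p j * (D i i + D j j - 2 * D i j) =
      2 * ∑ i, p i * (D i i - ∑ j, p j * D i j) := by
    have e1 : ∑ i, ∑ j, p i * p j * D i i = ∑ i, p i * D i i := by
      refine Finset.sum_congr rfl fun i _ => ?_
      simp_rw [mul_right_comm (p i) _ (D i i)]
      rw [← Finset.mul_sum, hp1, mul_one]
    have e2 : ∑ i, ∑ j, p i * p j * D j j = ∑ i, p i * D i i := by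
      rw [Finset.sum_comm]
      refine Eq.trans ?_ e1
      exact Finset.sum_congr rfl fun i _ => Finset.sum_congr rfl fun j _ => by ring
    have e3 : ∑ i, p i * (D i i - ∑ j, p j * D i j) =
        ∑ i, p i * D i i - ∑ i, ∑ j, p i * p j * D i j := by
      rw [← Finset.sum_sub_distrib]
      refine Finset.sum_congr rfl fun i _ => ?_
      rw [mul_sub, Finset.mul_sum]
      simp_rw [mul_assoc]
    have e4 : ∑ i, ∑ j, p i * p j * (D i i + D j j - 2 * D i j) =
        ∑ i, ∑ j, p i * p j * D i i + ∑ i, ∑ j, p i * p j * D j j -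
          2 * ∑ i, ∑ j, p i * p j * D i j := by
      rw [Finset.mul_sum, ← Finset.sum_add_distrib, ← Finset.sum_sub_distrib]
      refine Finset.sum_congr rfl fun i _ => ?_
      rw [Finset.mul_sum, ← Finset.sum_add_distrib, ← Finset.sum_sub_distrib]
      exact Finset.sum_congr rfl fun j _ => by ring
    rw [e4, e1, e2, e3]
    ring
  have h2 : 0 ≤ ∑ i, ∑ j, p i * p j * (D i i + D j j - 2 * D i j) :=
    Finset.sum_nonneg fun i _ => Finset.sum_nonneg fun j _ =>
      mul_nonneg (mul_nonneg (hp i) (hp j)) (hD i j)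
  linarith

end LogSumExp

/-! ### Gaussian interpolation and the Sudakov–Fernique inequality -/

section SudakovFernique

variable {ι : Type*} [Fintype ι]

/-- The second moment `∫ xᵢ xⱼ` of a measure on `ℝ^ι`. -/
noncomputable def secondMoment (μ : Measure (ι → ℝ)) (i j : ι) : ℝ := ∫ x, x i * x j ∂μ

lemma memLp_eval (μ : Measure (ι → ℝ)) [IsGaussian μ] (i : ι) :
    MemLp (fun x : ι → ℝ => x i) 2 μ :=
  ((IsGaussian.hasGaussianLaw_id (μ := μ)).map_fun (ContinuousLinearMap.proj i)).memLp_two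

lemma integrable_eval_mul_eval (μ : Measure (ι → ℝ)) [IsGaussian μ] (i j : ι) :
    Integrable (fun x : ι → ℝ => x i * x j) μ :=
  (memLp_eval μ i).integrable_mul (memLp_eval μ j)

lemma integrable_eval (μ : Measure (ι → ℝ)) [IsGaussian μ] (i : ι) :
    Integrable (fun x : ι → ℝ => x i) μ :=
  (memLp_eval μ i).integrable (by norm_num)

/-- Gaussian integration by parts in the direction of a row of the covariance matrix. -/
lemma integral_eval_mul_eq (μ : Measure (ι → ℝ)) [IsGaussian μ] (h0 : ∀ i, ∫ x, x i ∂μ = 0)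
    (i : ι) {f g : (ι → ℝ) → ℝ} {K : ℝ} (hf : Measurable f) (hg : Measurable g)
    (hfK : ∀ x, |f x| ≤ K) (hgK : ∀ x, |g x| ≤ K)
    (hder : ∀ x s, HasDerivAt (fun r : ℝ => f (x + r • secondMoment μ i))
      (g (x + s • secondMoment μ i)) s) :
    ∫ x, x i * f x ∂μ = ∫ x, g x ∂μ := by
  set c := secondMoment μ i with hc
  have hv0 : 0 ≤ c i := integral_nonneg fun x => mul_self_nonneg _
  -- If x_i has variance zero, it vanishes almost surely, so the whole covariance row is zero; then
  -- f is constant in that direction and g, its derivative, vanishes.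
  rcases hv0.eq_or_lt with hv | hv
  · have hae : ∀ᵐ x ∂μ, x i = 0 := by
      have h1 : ∫ x, x i * x i ∂μ = 0 := hv.symm
      rw [integral_eq_zero_iff_of_nonneg (fun x => mul_self_nonneg _)
        (integrable_eval_mul_eval μ i i)] at h1
      filter_upwards [h1] with x hx
      simpa using hx
    have hc0 : c = 0 := by
      ext j
      refine integral_eq_zero_of_ae ?_
      filter_upwards [hae] with x hx
      simp [hx]
    have hg0 : ∀ x, g x = 0 := by
      intro x
      have h1 := hder x 0
      rw [hc0] at h1
      simp only [smul_zero, add_zero] at h1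
      exact h1.unique (hasDerivAt_const _ _)
    simp_rw [hg0]
    rw [integral_zero]
    refine integral_eq_zero_of_ae ?_
    filter_upwards [hae] with x hx
    simp [hx]
  -- Regression on x_i: x = W + (x_i / c_i) c, where W is uncorrelated with x_i and hence, by joint
  -- Gaussianity, independent of it. With W frozen the claim is the one-dimensional Stein identity.
  · let U : (ι → ℝ) → ℝ := fun x => x i
    let W : (ι → ℝ) → ι → ℝ := fun x j => x j - x i * (c j / c i)
    have hid : HasGaussianLaw (fun x : ι → ℝ => x) μ := IsGaussian.hasGaussianLaw_id
    have hjoint : HasGaussianLaw (fun x => ((fun _ : Unit => U x), fun j => W x j)) μ := by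
      let L : (ι → ℝ) →L[ℝ] (Unit → ℝ) × (ι → ℝ) :=
        (ContinuousLinearMap.pi fun _ => ContinuousLinearMap.proj i).prod
          (ContinuousLinearMap.pi fun j => ContinuousLinearMap.proj j -
            (c j / c i) • ContinuousLinearMap.proj i)
      have hL : (fun x => ((fun _ : Unit => U x), fun j => W x j)) = fun x => L x := by
        funext x
        refine Prod.ext rfl (funext fun j => ?_)
        simp [L, W, mul_comm]
      rw [hL]
      exact hid.map_fun L
    have hUW : IndepFun U W μ := by
      have h1 := hjoint.indepFun_of_covariance_eval (X := fun _ : Unit => U)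
        (Y := fun j x => W x j) fun _ j => ?_
      · exact h1.comp (φ := fun u : Unit → ℝ => u ()) (ψ := id) (by fun_prop) measurable_id
      · have hW : MemLp (fun x => W x j) 2 μ :=
          (memLp_eval μ j).sub ((memLp_eval μ i).mul_const _)
        rw [covariance_eq_sub (memLp_eval μ i) hW]
        have h2 : ∀ x, (U * fun x => W x j) x = x i * x j - x i * x i * (c j / c i) := fun x => by
          simp only [Pi.mul_apply, U, W]; ring
        have h3 : ∫ x, (U * fun x => W x j) x ∂μ =
            ∫ x, (x i * x j - x i * x i * (c j / c i)) ∂μ :=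
          integral_congr_ae (Filter.Eventually.of_forall h2)
        rw [h3, integral_sub (integrable_eval_mul_eval μ i j)
          ((integrable_eval_mul_eval μ i i).mul_const _), integral_mul_const]
        change c j - c i * (c j / c i) - (∫ x, x i ∂μ) * _ = 0
        rw [h0]
        field_simp
        ring
    have hUm : Measurable U := measurable_pi_apply i
    have hWm : Measurable W := by fun_prop
    have hUlaw : μ.map U = gaussianReal 0 (c i).toNNReal := by
      have h1 : μ.map (fun x => x i) = gaussianReal (∫ x, x i ∂μ) Var[fun x => x i; μ].toNNReal :=
        (hid.map_fun (ContinuousLinearMap.proj i)).map_eq_gaussianReal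
      have h2 : Var[fun x : ι → ℝ => x i; μ] = c i := by
        rw [variance_of_integral_eq_zero (measurable_pi_apply i).aemeasurable (h0 i)]
        simp only [hc, secondMoment, sq]
      rw [h0, h2] at h1
      exact h1
    have hprod : μ.map (fun x => (U x, W x)) =
        (gaussianReal 0 (c i).toNNReal).prod (μ.map W) := by
      rw [← hUlaw]
      exact (indepFun_iff_map_prod_eq_prod_map_map hUm.aemeasurable hWm.aemeasurable).1 hUW
    have hrec : ∀ x, W x + (U x / c i) • c = x := by
      intro x
      ext j
      simp only [Pi.add_apply, Pi.smul_apply, smul_eq_mul, W, U]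
      field_simp
      ring
    have hcm : Measurable fun p : ℝ × (ι → ℝ) => p.2 + (p.1 / c i) • c := by fun_prop
    have hUWm : AEMeasurable (fun x => (U x, W x)) μ := (hUm.prodMk hWm).aemeasurable
    have hWprob : IsProbabilityMeasure (μ.map W) :=
      Measure.isProbabilityMeasure_map hWm.aemeasurable
    have htransfer : ∀ F : ℝ → (ι → ℝ) → ℝ, Measurable (Function.uncurry F) →
        Integrable (fun x => F (U x) (W x)) μ →
        ∫ x, F (U x) (W x) ∂μ =
          ∫ w, ∫ u, F u w ∂(gaussianReal 0 (c i).toNNReal) ∂(μ.map W) := by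
      intro F hF hFi
      have h1 := integral_map hUWm (f := Function.uncurry F) hF.aestronglyMeasurable
      have h2 := (integrable_map_measure (f := fun x => (U x, W x)) (g := Function.uncurry F)
        hF.aestronglyMeasurable hUWm).2 hFi
      rw [hprod] at h1 h2
      rw [integral_prod_symm _ h2] at h1
      exact h1.symm
    have hL := htransfer (fun u w => u * f (w + (u / c i) • c))
      (measurable_fst.mul (hf.comp hcm)) ?_
    · have hR := htransfer (fun u w => g (w + (u / c i) • c)) (hg.comp hcm) ?_
      · simp only [hrec] at hL hR
        rw [hL, hR]
        refine integral_congr_ae (Filter.Eventually.of_forall fun w => ?_)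
        have hstein := integral_mul_gaussianReal (c i).toNNReal
          (f := fun u => c i * f (w + (u / c i) • c)) (f' := fun u => g (w + (u / c i) • c))
          (K := (c i + 1) * K) ?_ (by fun_prop) ?_ ?_
        · simp_rw [mul_left_comm _ (c i)] at hstein
          rw [integral_const_mul, Real.coe_toNNReal _ hv.le] at hstein
          exact mul_left_cancel₀ hv.ne' hstein
        · intro u
          have h1 := (hder w (u / c i)).scomp u ((hasDerivAt_id u).div_const (c i))
          have h2 := h1.const_mul (c i)
          convert! h2 using 1
          simp only [smul_eq_mul]
          field_simp
        · intro u
          rw [abs_mul, abs_of_pos hv]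
          have := hfK (w + (u / c i) • c)
          have hK0 : 0 ≤ K := (abs_nonneg _).trans this
          nlinarith
        · intro u
          have := hgK (w + (u / c i) • c)
          have hK0 : 0 ≤ K := (abs_nonneg _).trans this
          nlinarith
      · simp only [hrec]
        exact (integrable_const K).mono' hg.aestronglyMeasurable (Filter.Eventually.of_forall hgK)
    · simp only [hrec]
      have := (integrable_eval μ i).bdd_mul hf.aestronglyMeasurable
        (Filter.Eventually.of_forall hfK)
      exact this.congr (Filter.Eventually.of_forall fun x => mul_comm _ _)

variable [Nonempty ι]

lemma abs_softmax_mul_sub_le (a : ι → ℝ) (x : ι → ℝ) (i : ι) :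
    |softmax x i * (a i - ∑ j, softmax x j * a j)| ≤ |a i| + ∑ j, |a j| := by
  rw [abs_mul]
  have h1 : |a i - ∑ j, softmax x j * a j| ≤ |a i| + ∑ j, |a j| := by
    refine (abs_sub _ _).trans (add_le_add le_rfl ((Finset.abs_sum_le_sum_abs _ _).trans
      (Finset.sum_le_sum fun j _ => ?_)))
    rw [abs_mul]
    exact mul_le_of_le_one_left (abs_nonneg _) (abs_softmax_le_one x j)
  calc _ ≤ 1 * (|a i| + ∑ j, |a j|) := by
        gcongr
        exact abs_softmax_le_one x i
    _ = _ := one_mul _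

lemma continuous_softmax_mul_sub (a : ι → ℝ) (i : ι) :
    Continuous fun x : ι → ℝ => softmax x i * (a i - ∑ j, softmax x j * a j) :=
  (continuous_softmax i).mul (continuous_const.sub
    (continuous_finsetSum _ fun j _ => (continuous_softmax j).mul continuous_const))

/-- Gaussian integration by parts in the first vector with the second one fixed; the factor `a` is
the chain rule for a x + b y. -/
lemma integral_fst_mul_softmax (μ ν : Measure (ι → ℝ)) [IsGaussian μ] [IsProbabilityMeasure ν]
    (hμ : ∀ i, ∫ x, x i ∂μ = 0) (a b : ℝ) (i : ι) :
    ∫ p : (ι → ℝ) × (ι → ℝ), p.1 i * softmax (a • p.1 + b • p.2) i ∂(μ.prod ν) =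
      a * ∫ p : (ι → ℝ) × (ι → ℝ), softmax (a • p.1 + b • p.2) i *
        (secondMoment μ i i - ∑ j, softmax (a • p.1 + b • p.2) j * secondMoment μ i j)
          ∂(μ.prod ν) := by
  have hlin : Continuous fun p : (ι → ℝ) × (ι → ℝ) => a • p.1 + b • p.2 := by fun_prop
  have hS : Continuous fun p : (ι → ℝ) × (ι → ℝ) => softmax (a • p.1 + b • p.2) i :=
    (continuous_softmax i).comp hlin
  have hQ := (continuous_softmax_mul_sub (secondMoment μ i) i).comp hlin
  have hI1 : Integrable (fun p : (ι → ℝ) × (ι → ℝ) => p.1 i * softmax (a • p.1 + b • p.2) i)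
      (μ.prod ν) := by
    have h1 : Integrable (fun p : (ι → ℝ) × (ι → ℝ) => p.1 i) (μ.prod ν) :=
      (integrable_eval μ i).comp_fst ν
    exact (h1.bdd_mul hS.aestronglyMeasurable (Filter.Eventually.of_forall fun p =>
      abs_softmax_le_one _ _)).congr (Filter.Eventually.of_forall fun p => mul_comm _ _)
  have hI2 : Integrable (fun p : (ι → ℝ) × (ι → ℝ) => softmax (a • p.1 + b • p.2) i *
      (secondMoment μ i i - ∑ j, softmax (a • p.1 + b • p.2) j * secondMoment μ i j))
      (μ.prod ν) :=
    (integrable_const _).mono' hQ.aestronglyMeasurable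
      (Filter.Eventually.of_forall fun p => abs_softmax_mul_sub_le _ _ _)
  rw [integral_prod_symm _ hI1, integral_prod_symm _ hI2, ← integral_const_mul]
  refine integral_congr_ae (Filter.Eventually.of_forall fun y => ?_)
  simp only
  have hlin' : Continuous fun x : ι → ℝ => a • x + b • y := by fun_prop
  rw [← integral_const_mul]
  set c := secondMoment μ i with hc
  refine integral_eval_mul_eq μ hμ i (K := 1 + |a| * (|c i| + ∑ j, |c j|))
    ((continuous_softmax i).comp hlin').measurable
    (((continuous_softmax_mul_sub c i).comp hlin').measurable.const_mul a) ?_ ?_ ?_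
  · intro x
    have h1 := abs_softmax_le_one (a • x + b • y) i
    have h2 : 0 ≤ |a| * (|c i| + ∑ j, |c j|) := by positivity
    linarith
  · intro x
    have h1 := abs_softmax_mul_sub_le c (a • x + b • y) i
    rw [abs_mul]
    have h2 := mul_le_mul_of_nonneg_left h1 (abs_nonneg a)
    linarith
  · intro x s
    have h1 := hasDerivAt_softmax (x := fun r : ℝ => a • (x + r • c) + b • y)
      (x' := fun j => a * c j) (s := s) ?_ i
    · convert! h1 using 1
      have h2 : ∀ q : ι → ℝ, ∑ j, q j * (a * c j) = a * ∑ j, q j * c j := fun q => by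
        rw [Finset.mul_sum]
        exact Finset.sum_congr rfl fun j _ => by ring
      rw [h2]
      ring
    · intro j
      have h3 : HasDerivAt (fun r : ℝ => a * (x j + r * c j) + b * y j) (a * c j) s := by
        simpa using ((((hasDerivAt_id s).mul_const (c j)).const_add (x j)).const_mul a).add_const
          (b * y j)
      exact h3

/-- Interpolate between independent copies by sin θ · x + cos θ · y, which has law ν at θ = 0 and μ
at θ = π/2. After integration by parts, the derivative in θ is sin θ cos θ times the mean of the
quadratic expression of `sum_mul_diag_sub_nonneg` for the difference of covariances, hence
nonnegative on [0, π/2]. -/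
lemma integral_logSumExp_le (μ ν : Measure (ι → ℝ)) [IsGaussian μ] [IsGaussian ν]
    (hμ : ∀ i, ∫ x, x i ∂μ = 0) (hν : ∀ i, ∫ x, x i ∂ν = 0)
    (h : ∀ i j, ∫ x, (x i - x j) ^ 2 ∂ν ≤ ∫ x, (x i - x j) ^ 2 ∂μ) :
    ∫ x, logSumExp x ∂ν ≤ ∫ x, logSumExp x ∂μ := by
  let Z : ℝ → (ι → ℝ) × (ι → ℝ) → ι → ℝ := fun θ p => Real.sin θ • p.1 + Real.cos θ • p.2
  have hZ : ∀ θ, Continuous (Z θ) := fun θ => by fun_prop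
  let φ : ℝ → ℝ := fun θ => ∫ p, logSumExp (Z θ p) ∂(μ.prod ν)
  let G : ℝ → (ι → ℝ) × (ι → ℝ) → ℝ := fun θ p =>
    ∑ i, softmax (Z θ p) i * (Real.cos θ * p.1 i - Real.sin θ * p.2 i)
  have hfst : ∀ i, Integrable (fun p : (ι → ℝ) × (ι → ℝ) => p.1 i) (μ.prod ν) := fun i =>
    (integrable_eval μ i).comp_fst ν
  have hsnd : ∀ i, Integrable (fun p : (ι → ℝ) × (ι → ℝ) => p.2 i) (μ.prod ν) := fun i =>
    (integrable_eval ν i).comp_snd μ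
  have hbd : Integrable (fun p : (ι → ℝ) × (ι → ℝ) => ∑ i, (|p.1 i| + |p.2 i|)) (μ.prod ν) :=
    integrable_finsetSum _ fun i _ => (hfst i).abs.add (hsnd i).abs
  have hlin : ∀ (a b x y : ℝ), |a| ≤ 1 → |b| ≤ 1 → |a * x + b * y| ≤ |x| + |y| := by
    intro a b x y ha hb
    refine (abs_add_le _ _).trans ?_
    rw [abs_mul, abs_mul]
    exact add_le_add (mul_le_of_le_one_left (abs_nonneg _) ha)
      (mul_le_of_le_one_left (abs_nonneg _) hb)
  have hderiv : ∀ θ, HasDerivAt φ (∫ p, G θ p ∂(μ.prod ν)) θ := by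
    intro θ
    refine (hasDerivAt_integral_of_dominated_loc_of_deriv_le (s := Set.univ) Filter.univ_mem
      (Filter.Eventually.of_forall fun θ =>
        (continuous_logSumExp.comp (hZ θ)).aestronglyMeasurable) ?_ ?_ ?_ hbd ?_).2
    · refine (hbd.add (integrable_const (Real.log (Fintype.card ι)))).mono'
        (continuous_logSumExp.comp (hZ θ)).aestronglyMeasurable
        (Filter.Eventually.of_forall fun p => ?_)
      refine (abs_logSumExp_le _).trans (add_le_add (Finset.sum_le_sum fun i _ => ?_) le_rfl)
      exact hlin _ _ _ _ (Real.abs_sin_le_one θ) (Real.abs_cos_le_one θ)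
    · refine Continuous.aestronglyMeasurable (continuous_finsetSum _ fun i _ => ?_)
      exact ((continuous_softmax i).comp (hZ θ)).mul (by fun_prop)
    · refine Filter.Eventually.of_forall fun p θ _ => ?_
      refine (Finset.abs_sum_le_sum_abs _ _).trans (Finset.sum_le_sum fun i _ => ?_)
      rw [abs_mul]
      refine (mul_le_of_le_one_left (abs_nonneg _) (abs_softmax_le_one _ _)).trans ?_
      have := hlin (Real.cos θ) (-Real.sin θ) (p.1 i) (p.2 i) (Real.abs_cos_le_one θ)
        (by rw [abs_neg]; exact Real.abs_sin_le_one θ)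
      rwa [neg_mul, ← sub_eq_add_neg] at this
    · refine Filter.Eventually.of_forall fun p θ _ => hasDerivAt_logSumExp fun i => ?_
      have h1 := ((Real.hasDerivAt_sin θ).mul_const (p.1 i)).add
        ((Real.hasDerivAt_cos θ).mul_const (p.2 i))
      convert! h1 using 1
      ring
  have hnonneg : ∀ θ, 0 ≤ Real.sin θ → 0 ≤ Real.cos θ → 0 ≤ ∫ p, G θ p ∂(μ.prod ν) := by
    intro θ hs hc
    have hS : ∀ i, Continuous fun p => softmax (Z θ p) i := fun i =>
      (continuous_softmax i).comp (hZ θ)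
    have hI : ∀ (q : (ι → ℝ) × (ι → ℝ) → ℝ) (i : ι), Integrable q (μ.prod ν) →
        Integrable (fun p => q p * softmax (Z θ p) i) (μ.prod ν) := fun q i hq =>
      (hq.bdd_mul (hS i).aestronglyMeasurable (Filter.Eventually.of_forall fun p =>
        abs_softmax_le_one _ _)).congr (Filter.Eventually.of_forall fun p => mul_comm _ _)
    have hT : ∀ (a : ι → ℝ) (i : ι), Integrable (fun p => softmax (Z θ p) i *
        (a i - ∑ j, softmax (Z θ p) j * a j)) (μ.prod ν) := fun a i =>
      (integrable_const _).mono' ((continuous_softmax_mul_sub a i).comp (hZ θ)).aestronglyMeasurable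
        (Filter.Eventually.of_forall fun p => abs_softmax_mul_sub_le _ _ _)
    have e1 : ∀ i, ∫ p, p.1 i * softmax (Z θ p) i ∂(μ.prod ν) = Real.sin θ *
        ∫ p, softmax (Z θ p) i * (secondMoment μ i i -
          ∑ j, softmax (Z θ p) j * secondMoment μ i j) ∂(μ.prod ν) := fun i =>
      integral_fst_mul_softmax μ ν hμ _ _ i
    have e2 : ∀ i, ∫ p, p.2 i * softmax (Z θ p) i ∂(μ.prod ν) = Real.cos θ *
        ∫ p, softmax (Z θ p) i * (secondMoment ν i i -
          ∑ j, softmax (Z θ p) j * secondMoment ν i j) ∂(μ.prod ν) := by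
      intro i
      -- The same formula with the two factors, and sine and cosine, exchanged.
      have h1 := integral_fst_mul_softmax ν μ hν (Real.cos θ) (Real.sin θ) i
      rw [← integral_prod_swap, ← integral_prod_swap (fun p : (ι → ℝ) × (ι → ℝ) =>
        softmax (Real.cos θ • p.1 + Real.sin θ • p.2) i * _)] at h1
      simp only [Prod.fst_swap, Prod.snd_swap, add_comm (Real.cos θ • _)] at h1
      exact h1
    have e3 : ∫ p, G θ p ∂(μ.prod ν) = Real.sin θ * Real.cos θ *
        ∫ p, ∑ i, softmax (Z θ p) i * ((secondMoment μ i i - secondMoment ν i i) -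
          ∑ j, softmax (Z θ p) j * (secondMoment μ i j - secondMoment ν i j)) ∂(μ.prod ν) := by
      have h1 : ∀ p, G θ p = ∑ i, (Real.cos θ * (p.1 i * softmax (Z θ p) i) -
          Real.sin θ * (p.2 i * softmax (Z θ p) i)) := fun p =>
        Finset.sum_congr rfl fun i _ => by ring
      have h2 : ∀ p, ∑ i, softmax (Z θ p) i * ((secondMoment μ i i - secondMoment ν i i) -
          ∑ j, softmax (Z θ p) j * (secondMoment μ i j - secondMoment ν i j)) =
          ∑ i, (softmax (Z θ p) i * (secondMoment μ i i -
            ∑ j, softmax (Z θ p) j * secondMoment μ i j) -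
            softmax (Z θ p) i * (secondMoment ν i i -
            ∑ j, softmax (Z θ p) j * secondMoment ν i j)) := fun p =>
        Finset.sum_congr rfl fun i _ => by
          simp_rw [mul_sub (softmax (Z θ p) _) (secondMoment μ i _) (secondMoment ν i _)]
          rw [Finset.sum_sub_distrib]
          ring
      have hI1 : ∀ i, Integrable (fun p => Real.cos θ * (p.1 i * softmax (Z θ p) i))
          (μ.prod ν) := fun i => (hI _ i (hfst i)).const_mul _
      have hI2 : ∀ i, Integrable (fun p => Real.sin θ * (p.2 i * softmax (Z θ p) i))
          (μ.prod ν) := fun i => (hI _ i (hsnd i)).const_mul _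
      simp_rw [h1, h2]
      rw [integral_finsetSum _ fun i _ => by exact (hI1 i).sub (hI2 i),
        integral_finsetSum _ fun i _ => by exact (hT _ i).sub (hT _ i), Finset.mul_sum]
      refine Finset.sum_congr rfl fun i _ => ?_
      rw [integral_sub (hI1 i) (hI2 i),
        integral_sub (hT _ i) (hT _ i), integral_const_mul, integral_const_mul, e1, e2]
      ring
    rw [e3]
    refine mul_nonneg (mul_nonneg hs hc) (integral_nonneg fun p => ?_)
    have hsq : ∀ (ρ : Measure (ι → ℝ)) [IsGaussian ρ] (i j : ι), ∫ x, (x i - x j) ^ 2 ∂ρ =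
        secondMoment ρ i i + secondMoment ρ j j - 2 * secondMoment ρ i j := by
      intro ρ _ i j
      have h1 : ∀ x : ι → ℝ, (x i - x j) ^ 2 = x i * x i + x j * x j - 2 * (x i * x j) :=
        fun x => by ring
      simp_rw [h1]
      have h2 : Integrable (fun x => x i * x i + x j * x j) ρ :=
        (integrable_eval_mul_eval ρ i i).add (integrable_eval_mul_eval ρ j j)
      rw [integral_sub h2 ((integrable_eval_mul_eval ρ i j).const_mul 2),
        integral_add (integrable_eval_mul_eval ρ i i) (integrable_eval_mul_eval ρ j j),
        integral_const_mul]
      rfl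
    refine sum_mul_diag_sub_nonneg (D := fun i j => secondMoment μ i j - secondMoment ν i j)
      (softmax_nonneg _) (sum_softmax _) fun i j => ?_
    have h1 := h i j
    rw [hsq ν, hsq μ] at h1
    linarith
  have hmono : MonotoneOn φ (Set.Icc 0 (Real.pi / 2)) := by
    refine monotoneOn_of_deriv_nonneg (convex_Icc _ _)
      (fun θ _ => (hderiv θ).continuousAt.continuousWithinAt)
      (fun θ _ => (hderiv θ).differentiableAt.differentiableWithinAt) fun θ hθ => ?_
    rw [interior_Icc] at hθ
    rw [(hderiv θ).deriv]
    exact hnonneg θ (Real.sin_nonneg_of_nonneg_of_le_pi hθ.1.le (by linarith [hθ.2, Real.pi_pos]))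
      (Real.cos_nonneg_of_neg_pi_div_two_le_of_le (by linarith [hθ.1, Real.pi_pos]) hθ.2.le)
  have hpi : 0 ≤ Real.pi / 2 := by positivity
  have hle := hmono (Set.left_mem_Icc.2 hpi) (Set.right_mem_Icc.2 hpi) hpi
  have hφ0 : φ 0 = ∫ x, logSumExp x ∂ν := by
    simp only [φ, Z, Real.sin_zero, Real.cos_zero, zero_smul, one_smul, zero_add]
    rw [integral_fun_snd (μ := μ) (ν := ν) (f := fun y : ι → ℝ => logSumExp y)]
    simp
  have hφ1 : φ (Real.pi / 2) = ∫ x, logSumExp x ∂μ := by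
    simp only [φ, Z, Real.sin_pi_div_two, Real.cos_pi_div_two, zero_smul, one_smul, add_zero]
    rw [integral_fun_fst (μ := μ) (ν := ν) (f := fun y : ι → ℝ => logSumExp y)]
    simp
  rwa [hφ0, hφ1] at hle

section

variable {Ω : Type*} [MeasurableSpace Ω] {P : Measure Ω} {X : ι → Ω → ℝ}

lemma ProbabilityTheory.HasGaussianLaw.integrable_iSup (hX : HasGaussianLaw (fun ω i => X i ω) P) :
    Integrable (fun ω => ⨆ i, X i ω) P := by
  have hs : Integrable (fun ω => ∑ i, |X i ω|) P :=
    integrable_finsetSum _ fun i _ => (hX.eval i).integrable.abs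
  have hle : ∀ ω i, |X i ω| ≤ ∑ i, |X i ω| := fun ω i =>
    Finset.single_le_sum (f := fun i => |X i ω|) (fun _ _ => abs_nonneg _) (Finset.mem_univ i)
  refine hs.mono' (AEMeasurable.iSup fun i => (hX.eval i).aemeasurable).aestronglyMeasurable
    (Filter.Eventually.of_forall fun ω => abs_le.2 ⟨?_, ciSup_le fun i =>
      (le_abs_self _).trans (hle ω i)⟩)
  obtain ⟨i⟩ := ‹Nonempty ι›
  exact (neg_le_neg (hle ω i)).trans ((neg_abs_le _).trans
    (le_ciSup (f := fun i => X i ω) (Set.finite_range _).bddAbove i))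

lemma ProbabilityTheory.HasGaussianLaw.integrable_logSumExp
    (hX : HasGaussianLaw (fun ω i => X i ω) P) :
    Integrable (fun ω => logSumExp fun i => X i ω) P := by
  have := hX.isProbabilityMeasure
  have hs : Integrable (fun ω => ∑ i, |X i ω|) P :=
    integrable_finsetSum _ fun i _ => (hX.eval i).integrable.abs
  exact (hs.add (integrable_const (Real.log (Fintype.card ι)))).mono'
    (continuous_logSumExp.measurable.comp_aemeasurable hX.aemeasurable).aestronglyMeasurable
    (Filter.Eventually.of_forall fun ω => abs_logSumExp_le _)

end

/-- The **Sudakov–Fernique inequality**: the expected maximum of a centered Gaussian vector is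
monotone in the distances between its coordinates. -/
theorem sudakov_fernique {Ω Ω' : Type*} [MeasurableSpace Ω] [MeasurableSpace Ω'] {P : Measure Ω}
    {Q : Measure Ω'} {X : ι → Ω → ℝ} {Y : ι → Ω' → ℝ}
    (hX : HasGaussianLaw (fun ω i => X i ω) P) (hY : HasGaussianLaw (fun ω i => Y i ω) Q)
    (hX0 : ∀ i, ∫ ω, X i ω ∂P = 0) (hY0 : ∀ i, ∫ ω, Y i ω ∂Q = 0)
    (h : ∀ i j, ∫ ω, (Y i ω - Y j ω) ^ 2 ∂Q ≤ ∫ ω, (X i ω - X j ω) ^ 2 ∂P) :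
    ∫ ω, ⨆ i, Y i ω ∂Q ≤ ∫ ω, ⨆ i, X i ω ∂P := by
  have hP := hX.isProbabilityMeasure
  have hQ := hY.isProbabilityMeasure
  -- Log-sum-exp of βx lies between β max x and β max x + log |ι|; comparing the scaled vectors
  -- costs log |ι| / β, which vanishes as β grows.
  have key : ∀ β : ℝ, 0 < β → ∫ ω, ⨆ i, Y i ω ∂Q ≤
      ∫ ω, ⨆ i, X i ω ∂P + Real.log (Fintype.card ι) / β := by
    intro β hβ
    have hXβ := hX.fun_smul β
    have hYβ := hY.fun_smul β
    have := hXβ.isGaussian_map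
    have := hYβ.isGaussian_map
    have hcomp := integral_logSumExp_le (P.map fun ω => β • fun i => X i ω)
      (Q.map fun ω => β • fun i => Y i ω) ?_ ?_ ?_
    · rw [integral_map hYβ.aemeasurable continuous_logSumExp.aestronglyMeasurable,
        integral_map hXβ.aemeasurable continuous_logSumExp.aestronglyMeasurable] at hcomp
      have hlow : β * ∫ ω, ⨆ i, Y i ω ∂Q ≤ ∫ ω, logSumExp (β • fun i => Y i ω) ∂Q := by
        rw [← integral_const_mul]
        refine integral_mono (hY.integrable_iSup.const_mul β) hYβ.integrable_logSumExp fun ω => ?_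
        simp only
        rw [Real.mul_iSup_of_nonneg hβ.le]
        exact ciSup_le fun i => le_logSumExp (β • fun i => Y i ω) i
      have hupp : ∫ ω, logSumExp (β • fun i => X i ω) ∂P ≤
          β * ∫ ω, ⨆ i, X i ω ∂P + Real.log (Fintype.card ι) := by
        have h1 : ∫ ω, (β * ⨆ i, X i ω) + Real.log (Fintype.card ι) ∂P =
            β * ∫ ω, ⨆ i, X i ω ∂P + Real.log (Fintype.card ι) := by
          rw [integral_add (hX.integrable_iSup.const_mul β) (integrable_const _),
            integral_const_mul,
            integral_const]
          simp
        rw [← h1]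
        refine integral_mono hXβ.integrable_logSumExp
          ((hX.integrable_iSup.const_mul β).add (integrable_const _))
          fun ω => logSumExp_le fun i => ?_
        exact mul_le_mul_of_nonneg_left
          (le_ciSup (f := fun i => X i ω) (Set.finite_range _).bddAbove i) hβ.le
      have h2 := hlow.trans (hcomp.trans hupp)
      have h3 : β * (∫ ω, ⨆ i, X i ω ∂P + Real.log (Fintype.card ι) / β) =
          β * ∫ ω, ⨆ i, X i ω ∂P + Real.log (Fintype.card ι) := by field_simp
      rw [← h3] at h2
      exact le_of_mul_le_mul_left h2 hβ
    · intro i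
      rw [integral_map hXβ.aemeasurable (measurable_pi_apply i).aestronglyMeasurable]
      simp [integral_const_mul, hX0]
    · intro i
      rw [integral_map hYβ.aemeasurable (measurable_pi_apply i).aestronglyMeasurable]
      simp [integral_const_mul, hY0]
    · intro i j
      rw [integral_map hXβ.aemeasurable (by fun_prop), integral_map hYβ.aemeasurable (by fun_prop)]
      simp only [Pi.smul_apply, smul_eq_mul, ← mul_sub, mul_pow]
      rw [integral_const_mul, integral_const_mul]
      exact mul_le_mul_of_nonneg_left (h i j) (by positivity)
  refine ge_of_tendsto (x := Filter.atTop) (f := fun β : ℝ =>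
    ∫ ω, ⨆ i, X i ω ∂P + Real.log (Fintype.card ι) / β) ?_
    (by filter_upwards [Filter.eventually_gt_atTop 0] with β hβ using key β hβ)
  simpa using tendsto_const_nhds.add
    ((tendsto_const_nhds (x := Real.log (Fintype.card ι))).div_atTop Filter.tendsto_id)
    (f := fun _ : ℝ => ∫ ω, ⨆ i, X i ω ∂P)

end SudakovFernique

/-! ### Independent standard Gaussian coordinates -/

section StandardGaussianVector

/-- The law of a vector of independent standard Gaussian variables. -/
noncomputable def gaussianPi (κ : Type*) [Fintype κ] : Measure (κ → ℝ) :=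
  Measure.pi fun _ => gaussianReal 0 1

variable {κ : Type*} [Fintype κ]

instance : IsProbabilityMeasure (gaussianPi κ) := by
  unfold gaussianPi; infer_instance

lemma map_eval_gaussianPi (α : κ) : (gaussianPi κ).map (fun ω => ω α) = gaussianReal 0 1 :=
  (measurePreserving_eval (fun _ : κ => gaussianReal 0 1) α).map_eq

lemma hasGaussianLaw_eval_gaussianPi (α : κ) :
    HasGaussianLaw (fun ω : κ → ℝ => ω α) (gaussianPi κ) where
  isGaussian_map := by
    rw [map_eval_gaussianPi]; infer_instance

lemma iIndepFun_gaussianPi :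
    iIndepFun (fun (α : κ) (ω : κ → ℝ) => ω α) (gaussianPi κ) :=
  iIndepFun_pi (X := fun (_ : κ) (x : ℝ) => x) fun _ => aemeasurable_id

lemma hasGaussianLaw_gaussianPi : HasGaussianLaw (fun ω : κ → ℝ => ω) (gaussianPi κ) :=
  iIndepFun_gaussianPi.hasGaussianLaw hasGaussianLaw_eval_gaussianPi

lemma integral_eval_gaussianPi (α : κ) : ∫ ω, ω α ∂(gaussianPi κ) = 0 := by
  rw [← integral_map (φ := fun ω : κ → ℝ => ω α) (f := fun x : ℝ => x)
    (measurable_pi_apply α).aemeasurable (by fun_prop), map_eval_gaussianPi,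
    integral_id_gaussianReal]

lemma variance_eval_gaussianPi (α : κ) : Var[fun ω : κ → ℝ => ω α; gaussianPi κ] = 1 := by
  have h := variance_id_map (μ := gaussianPi κ) (X := fun ω : κ → ℝ => ω α)
    (measurable_pi_apply α).aemeasurable
  rw [← h, map_eval_gaussianPi, variance_id_gaussianReal]
  rfl

lemma integrable_mul_gaussianPi (α β : κ) : Integrable (fun ω : κ → ℝ => ω α * ω β)
    (gaussianPi κ) :=
  (hasGaussianLaw_eval_gaussianPi α).memLp_two.integrable_mul
    (hasGaussianLaw_eval_gaussianPi β).memLp_two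

lemma integral_mul_gaussianPi [DecidableEq κ] (α β : κ) :
    ∫ ω, ω α * ω β ∂(gaussianPi κ) = if α = β then 1 else 0 := by
  split_ifs with h
  · subst h
    have h1 := variance_of_integral_eq_zero
      (measurable_pi_apply α).aemeasurable (integral_eval_gaussianPi α)
    rw [variance_eval_gaussianPi] at h1
    simp only [sq] at h1
    exact h1.symm
  · have h1 := (iIndepFun_gaussianPi (κ := κ)).indepFun h
    rw [h1.integral_fun_mul_eq_mul_integral (measurable_pi_apply α).aestronglyMeasurable
      (measurable_pi_apply β).aestronglyMeasurable, integral_eval_gaussianPi, zero_mul]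

lemma hasGaussianLaw_sub_gaussianPi (α β : κ) :
    HasGaussianLaw (fun ω : κ → ℝ => ω α - ω β) (gaussianPi κ) :=
  (hasGaussianLaw_gaussianPi.prodMk (X := fun α (ω : κ → ℝ) => ω α) α β).fun_sub

lemma integral_sub_mul_sub_gaussianPi [DecidableEq κ] (α β γ δ : κ) :
    ∫ ω, (ω α - ω β) * (ω γ - ω δ) ∂(gaussianPi κ) =
      (if α = γ then 1 else 0) - (if α = δ then 1 else 0) -
        ((if β = γ then 1 else 0) - (if β = δ then 1 else 0)) := by
  have h1 : ∀ ω : κ → ℝ, (ω α - ω β) * (ω γ - ω δ) =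
      (ω α * ω γ - ω α * ω δ) - (ω β * ω γ - ω β * ω δ) := fun ω => by ring
  have hi := integrable_mul_gaussianPi (κ := κ)
  have hi2 : ∀ α γ δ, Integrable (fun ω : κ → ℝ => ω α * ω γ - ω α * ω δ) (gaussianPi κ) :=
    fun α γ δ => (hi α γ).sub (hi α δ)
  simp_rw [h1]
  rw [integral_sub (hi2 _ _ _) (hi2 _ _ _), integral_sub (hi _ _) (hi _ _),
    integral_sub (hi _ _) (hi _ _)]
  simp only [integral_mul_gaussianPi]

lemma integral_abs_sub_gaussianPi {α β : κ} (h : α ≠ β) :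
    ∫ ω, |ω α - ω β| ∂(gaussianPi κ) = 2 / Real.sqrt Real.pi := by
  classical
  have h0 : ∫ ω, (ω α - ω β) ∂(gaussianPi κ) = 0 := by
    rw [integral_sub (hasGaussianLaw_eval_gaussianPi α).integrable
      (hasGaussianLaw_eval_gaussianPi β).integrable, integral_eval_gaussianPi,
      integral_eval_gaussianPi, sub_zero]
  have hv : Var[fun ω : κ → ℝ => ω α - ω β; gaussianPi κ] = 2 := by
    rw [variance_of_integral_eq_zero (hasGaussianLaw_sub_gaussianPi α β).aemeasurable h0]
    simp only [sq]
    rw [integral_sub_mul_sub_gaussianPi]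
    simp [h, h.symm]
    norm_num
  rw [(hasGaussianLaw_sub_gaussianPi α β).integral_abs h0, hv,
    Real.sqrt_div (by norm_num), show (2 : ℝ) * 2 = 2 ^ 2 by norm_num,
    Real.sqrt_sq (by norm_num)]

end StandardGaussianVector

/-! ### The comparison vector with three weights per level -/

section TernaryTree

variable {k : ℕ}

/-- Sums of independent Gaussian weights, one out of three for each of `k` levels. -/
noncomputable def ternarySum (k : ℕ) (a : ℝ) (i : Fin k → Fin 3) (ω : Fin k × Fin 3 → ℝ) : ℝ :=
  a * ∑ j, ω (j, i j)

lemma hasGaussianLaw_ternarySum (a : ℝ) :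
    HasGaussianLaw (fun ω i => ternarySum k a i ω) (gaussianPi (Fin k × Fin 3)) := by
  let L : (Fin k × Fin 3 → ℝ) →L[ℝ] ((Fin k → Fin 3) → ℝ) :=
    ContinuousLinearMap.pi fun i => a • ∑ j, ContinuousLinearMap.proj (j, i j)
  have hL : (fun ω i => ternarySum k a i ω) = fun ω => L ω := by
    funext ω i
    simp [L, ternarySum]
  rw [hL]
  exact hasGaussianLaw_gaussianPi.map_fun L

lemma integral_ternarySum (a : ℝ) (i : Fin k → Fin 3) :
    ∫ ω, ternarySum k a i ω ∂(gaussianPi (Fin k × Fin 3)) = 0 := by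
  unfold ternarySum
  rw [integral_const_mul, integral_finsetSum _ fun j _ =>
    (hasGaussianLaw_eval_gaussianPi (j, i j)).integrable]
  simp [integral_eval_gaussianPi]

/-- By independence of the levels the cross terms vanish, and each level on which the two choices
differ contributes 2a². -/
lemma integral_ternarySum_sub_sq_le (a : ℝ) (i i' : Fin k → Fin 3) :
    ∫ ω, (ternarySum k a i ω - ternarySum k a i' ω) ^ 2 ∂(gaussianPi (Fin k × Fin 3)) ≤
      2 * a ^ 2 * k := by
  have h1 : ∀ ω, (ternarySum k a i ω - ternarySum k a i' ω) ^ 2 =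
      a ^ 2 * ∑ j, ∑ l, (ω (j, i j) - ω (j, i' j)) * (ω (l, i l) - ω (l, i' l)) := by
    intro ω
    rw [← Finset.sum_mul_sum, ternarySum, ternarySum, ← mul_sub, ← Finset.sum_sub_distrib]
    ring
  have hi : ∀ j l : Fin k, Integrable (fun ω : Fin k × Fin 3 → ℝ =>
      (ω (j, i j) - ω (j, i' j)) * (ω (l, i l) - ω (l, i' l))) (gaussianPi (Fin k × Fin 3)) :=
    fun j l => (hasGaussianLaw_sub_gaussianPi _ _).memLp_two.integrable_mul
      (hasGaussianLaw_sub_gaussianPi _ _).memLp_two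
  simp_rw [h1]
  rw [integral_const_mul, integral_finsetSum _ fun j _ => integrable_finsetSum _ fun l _ => hi j l]
  have h2 : ∀ j : Fin k, ∫ ω, ∑ l, (ω (j, i j) - ω (j, i' j)) * (ω (l, i l) - ω (l, i' l))
      ∂(gaussianPi (Fin k × Fin 3)) ≤ 2 := by
    intro j
    rw [integral_finsetSum _ fun l _ => hi j l, Finset.sum_eq_single j]
    · rw [integral_sub_mul_sub_gaussianPi]
      split_ifs <;> norm_num
    · intro l _ hl
      rw [integral_sub_mul_sub_gaussianPi]
      simp [hl.symm]
    · simp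
  calc _ ≤ a ^ 2 * ∑ _j : Fin k, (2 : ℝ) := by
        gcongr with j
        exact h2 j
    _ = _ := by simp; ring

/-- The range of three numbers is half the sum of their pairwise gaps, which reduces the mean
maximum of three normals to first absolute moments. -/
lemma exists_sum_abs_sub_le (x : Fin 3 → ℝ) :
    ∃ c d, (|x 0 - x 1| + |x 1 - x 2| + |x 0 - x 2|) / 2 ≤ x c - x d := by
  obtain ⟨c, hc⟩ := Finite.exists_max x
  obtain ⟨d, hd⟩ := Finite.exists_min x
  refine ⟨c, d, ?_⟩
  have a0 := hc 0
  have a1 := hc 1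
  have a2 := hc 2
  have b0 := hd 0
  have b1 := hd 1
  have b2 := hd 2
  rcases abs_cases (x 0 - x 1) with h | h <;> rcases abs_cases (x 1 - x 2) with h' | h' <;>
    rcases abs_cases (x 0 - x 2) with h'' | h'' <;> linarith

/-- The expected maximum of the ternary sums. -/
lemma le_integral_iSup_ternarySum {a : ℝ} (ha : 0 ≤ a) :
    a * k * (3 / (2 * Real.sqrt Real.pi)) ≤
      ∫ ω, ⨆ i, ternarySum k a i ω ∂(gaussianPi (Fin k × Fin 3)) := by
  have hY := hasGaussianLaw_ternarySum (k := k) a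
  have hneg : HasGaussianLaw (fun ω i => -ternarySum k a i ω) (gaussianPi (Fin k × Fin 3)) :=
    hY.fun_neg
  -- The negated vector has the same increments, so comparison bounds its expected maximum; then max
  -- Y + max(-Y), the range, has mean at most 2 E max Y.
  have hsym : ∫ ω, ⨆ i, -ternarySum k a i ω ∂(gaussianPi (Fin k × Fin 3)) ≤
      ∫ ω, ⨆ i, ternarySum k a i ω ∂(gaussianPi (Fin k × Fin 3)) := by
    refine sudakov_fernique hY hneg (integral_ternarySum a) (fun i => ?_) fun i i' =>
      le_of_eq (integral_congr_ae (Filter.Eventually.of_forall fun ω => ?_))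
    · rw [integral_neg, integral_ternarySum, neg_zero]
    · simp only; ring
  have habs : ∀ (j : Fin k) (c d : Fin 3), Integrable (fun ω : Fin k × Fin 3 → ℝ =>
      |ω (j, c) - ω (j, d)|) (gaussianPi (Fin k × Fin 3)) := fun j c d =>
    (hasGaussianLaw_sub_gaussianPi _ _).integrable.abs
  have hrange : ∀ j : Fin k, Integrable (fun ω : Fin k × Fin 3 → ℝ => (|ω (j, 0) - ω (j, 1)| +
      |ω (j, 1) - ω (j, 2)| + |ω (j, 0) - ω (j, 2)|) / 2) (gaussianPi (Fin k × Fin 3)) := fun j =>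
    (((habs j 0 1).add (habs j 1 2)).add (habs j 0 2)).div_const 2
  have hval : ∀ j : Fin k, ∫ ω, (|ω (j, 0) - ω (j, 1)| + |ω (j, 1) - ω (j, 2)| +
      |ω (j, 0) - ω (j, 2)|) / 2 ∂(gaussianPi (Fin k × Fin 3)) = 3 / Real.sqrt Real.pi := by
    intro j
    have h12 : Integrable (fun ω : Fin k × Fin 3 → ℝ => |ω (j, 0) - ω (j, 1)| +
      |ω (j, 1) - ω (j, 2)|) (gaussianPi (Fin k × Fin 3)) := (habs j 0 1).add (habs j 1 2)
    rw [integral_div, integral_add h12 (habs j 0 2), integral_add (habs j 0 1) (habs j 1 2),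
      integral_abs_sub_gaussianPi (by simp), integral_abs_sub_gaussianPi (by simp),
      integral_abs_sub_gaussianPi (by simp)]
    ring
  have hlow : ∫ ω : Fin k × Fin 3 → ℝ, a * ∑ j, (|ω (j, 0) - ω (j, 1)| + |ω (j, 1) - ω (j, 2)| +
      |ω (j, 0) - ω (j, 2)|) / 2 ∂(gaussianPi (Fin k × Fin 3)) ≤
      ∫ ω, ((⨆ i, ternarySum k a i ω) + ⨆ i, -ternarySum k a i ω)
        ∂(gaussianPi (Fin k × Fin 3)) := by
    refine integral_mono ((integrable_finsetSum _ fun j _ => hrange j).const_mul a)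
      (hY.integrable_iSup.add hneg.integrable_iSup) fun ω => ?_
    -- The levels are chosen independently: take the largest weight on each level for one index and
    -- the smallest for the other.
    choose i i' hii' using fun j : Fin k => exists_sum_abs_sub_le fun c => ω (j, c)
    have h1 := le_ciSup (f := fun i => ternarySum k a i ω) (Set.finite_range _).bddAbove i
    have h2 := le_ciSup (f := fun i => -ternarySum k a i ω) (Set.finite_range _).bddAbove i'
    have h3 : a * ∑ j, (|ω (j, 0) - ω (j, 1)| + |ω (j, 1) - ω (j, 2)| +
        |ω (j, 0) - ω (j, 2)|) / 2 ≤ ternarySum k a i ω + -ternarySum k a i' ω := by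
      rw [ternarySum, ternarySum, ← sub_eq_add_neg, ← mul_sub, ← Finset.sum_sub_distrib]
      exact mul_le_mul_of_nonneg_left (Finset.sum_le_sum fun j _ => hii' j) ha
    exact h3.trans (add_le_add h1 h2)
  rw [integral_add hY.integrable_iSup hneg.integrable_iSup, integral_const_mul,
    integral_finsetSum _ fun j _ => hrange j] at hlow
  simp only [hval, Finset.sum_const, Finset.card_univ, Fintype.card_fin, nsmul_eq_mul] at hlow
  have h4 : a * k * (3 / (2 * Real.sqrt Real.pi)) = (a * (k * (3 / Real.sqrt Real.pi))) / 2 := by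
    ring
  rw [h4]
  linarith

end TernaryTree

/-! ### Lower bound from large increments -/

section LowerBound

namespace IsContinuousCenteredGaussian

variable {Ω : Type*} [MeasurableSpace Ω] {P : Measure Ω} {X : I → Ω → ℝ}

lemma integral_sub_sq (hX : IsContinuousCenteredGaussian X P) (s t : I) :
    ∫ ω, (X s ω - X t ω) ^ 2 ∂P = canonicalDist X P s t ^ 2 := by
  rw [canonicalDist, Real.sq_sqrt (variance_nonneg _ _), variance_of_integral_eq_zero
    (hX.hasGaussianLaw_sub s t).aemeasurable (hX.integral_sub_eq_zero s t)]
  rfl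

lemma le_canonicalDist (hX : IsContinuousCenteredGaussian X P) {C H : ℝ} {s t : I}
    (h : ENNReal.ofReal (C * |(s : ℝ) - t| ^ H) ≤ eLpNorm (X s - X t) 2 P) :
    C * |(s : ℝ) - t| ^ H ≤ canonicalDist X P s t := by
  rw [hX.eLpNorm_sub] at h
  exact (ENNReal.ofReal_le_ofReal_iff (canonicalDist_nonneg s t)).1 h

/-- Lower bound from the two endpoints of the unit interval. -/
lemma le_integral_iSup_of_endpoints (hX : IsContinuousCenteredGaussian X P) :
    canonicalDist X P 0 1 / Real.sqrt (2 * Real.pi) ≤ ∫ ω, ⨆ t, X t ω ∂P := by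
  -- The integrand on the left is max(X_0, X_1).
  have hlow : ∫ ω, ((X 0 ω + X 1 ω) / 2 + |(X 0 - X 1) ω| / 2) ∂P ≤ ∫ ω, ⨆ t, X t ω ∂P := by
    refine le_trans ?_ (hX.integral_iSup_finite_le fun b : Bool => if b then (1 : I) else 0)
    refine integral_mono
      ((((hX.integrable_eval 0).add (hX.integrable_eval 1)).div_const 2).add
        ((hX.hasGaussianLaw_sub 0 1).integrable.abs.div_const 2))
      (hX.integrable_iSup_countable _) fun ω => ?_
    have h0 := le_ciSup (f := fun b : Bool => X (if b then (1 : I) else 0) ω)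
      (Set.finite_range _).bddAbove false
    have h1 := le_ciSup (f := fun b : Bool => X (if b then (1 : I) else 0) ω)
      (Set.finite_range _).bddAbove true
    simp only [Bool.false_eq_true, if_false, if_true] at h0 h1
    simp only [Pi.sub_apply]
    rcases abs_cases (X 0 ω - X 1 ω) with h | h <;> linarith
  have hval : ∫ ω, ((X 0 ω + X 1 ω) / 2 + |(X 0 - X 1) ω| / 2) ∂P =
      canonicalDist X P 0 1 / Real.sqrt (2 * Real.pi) := by
    have hi : Integrable (fun ω => X 0 ω + X 1 ω) P :=
      (hX.integrable_eval 0).add (hX.integrable_eval 1)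
    rw [integral_add (hi.div_const 2) ((hX.hasGaussianLaw_sub 0 1).integrable.abs.div_const 2),
      integral_div, integral_div, integral_add (hX.integrable_eval 0) (hX.integrable_eval 1),
      hX.centered, hX.centered,
      (hX.hasGaussianLaw_sub 0 1).integral_abs (hX.integral_sub_eq_zero 0 1), canonicalDist,
      Real.sqrt_div (by have := variance_nonneg (X 0 - X 1) P; positivity),
      Real.sqrt_mul (by norm_num), Real.sqrt_mul (by norm_num)]
    have h2 : Real.sqrt 2 * Real.sqrt 2 = 2 := Real.mul_self_sqrt (by norm_num)
    have hpi : 0 < Real.sqrt Real.pi := Real.sqrt_pos.2 Real.pi_pos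
    field_simp
    linear_combination Real.sqrt Var[X 0 - X 1; P] * h2
  rwa [hval] at hlow

/-- Lower bound from `3 ^ k` equidistant points, by comparison with sums of independent weights. -/
lemma le_integral_iSup_of_grid (hX : IsContinuousCenteredGaussian X P) {C H : ℝ} (hC : 0 < C)
    (hH : 0 < H)
    (h : ∀ t s : I, ENNReal.ofReal (C * |(t : ℝ) - s| ^ H) ≤ eLpNorm (X t - X s) 2 P) (k : ℕ) :
    C * ((3 : ℝ) ^ k)⁻¹ ^ H * Real.sqrt (k / 2) * (3 / (2 * Real.sqrt Real.pi)) ≤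
      ∫ ω, ⨆ t, X t ω ∂P := by
  rcases Nat.eq_zero_or_pos k with rfl | hk
  · have h1 := hX.le_integral_iSup_of_endpoints
    have h2 : 0 ≤ canonicalDist X P 0 1 / Real.sqrt (2 * Real.pi) :=
      div_nonneg (canonicalDist_nonneg _ _) (Real.sqrt_nonneg _)
    simpa using h2.trans h1
  have hk0 : (0 : ℝ) < k := by exact_mod_cast hk
  set δ : ℝ := C * ((3 : ℝ) ^ k)⁻¹ ^ H with hδ
  have hδ0 : 0 < δ := by positivity
  -- Only the separation of distinct grid points by at least 3^(-k) matters, so any bijection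
  -- between digit strings and integers below 3^k would serve.
  let t : (Fin k → Fin 3) → I := fun i => gridPoint (3 ^ k) (finFunctionFinEquiv i)
  have ht : ∀ i, (t i : ℝ) = (finFunctionFinEquiv i : ℕ) / (3 : ℝ) ^ k := fun i => by
    simp only [t]
    rw [coe_gridPoint (finFunctionFinEquiv i).2.le]
    simp
  have hsep : ∀ i i', i ≠ i' → δ ≤ canonicalDist X P (t i) (t i') := by
    intro i i' hii'
    refine le_trans ?_ (hX.le_canonicalDist (h (t i) (t i')))
    have hne : ((finFunctionFinEquiv i : ℕ) : ℤ) - (finFunctionFinEquiv i' : ℕ) ≠ 0 := by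
      intro h0
      apply hii'
      apply finFunctionFinEquiv.injective
      apply Fin.ext
      omega
    have h1 : (1 : ℝ) ≤ |((finFunctionFinEquiv i : ℕ) : ℝ) - (finFunctionFinEquiv i' : ℕ)| := by
      exact_mod_cast Int.one_le_abs hne
    have h2 : ((3 : ℝ) ^ k)⁻¹ ≤ |(t i : ℝ) - t i'| := by
      rw [ht, ht, ← sub_div, abs_div, abs_of_pos (a := (3 : ℝ) ^ k) (by positivity),
        inv_eq_one_div]
      gcongr
    rw [hδ]
    gcongr
  -- Chosen so that the bound 2a²k on the squared increments equals δ².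
  set a : ℝ := δ / Real.sqrt (2 * k) with ha
  have hcomp := sudakov_fernique (hX.hasGaussianLaw_pi t) (hasGaussianLaw_ternarySum (k := k) a)
    (fun i => hX.centered _) (integral_ternarySum a) fun i i' => by
      rcases eq_or_ne i i' with rfl | hii'
      · simp
      · refine (integral_ternarySum_sub_sq_le a i i').trans ?_
        rw [hX.integral_sub_sq]
        have h1 : 2 * a ^ 2 * k = δ ^ 2 := by
          rw [ha, div_pow, Real.sq_sqrt (by positivity)]
          field_simp
        rw [h1]
        exact pow_le_pow_left₀ hδ0.le (hsep i i' hii') 2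
  refine le_trans ?_ ((le_integral_iSup_ternarySum (k := k) (a := a) (by positivity)).trans
    (hcomp.trans (hX.integral_iSup_finite_le t)))
  have h2 : a * k = δ * Real.sqrt (k / 2) := by
    have h3 : (k : ℝ) = Real.sqrt (2 * k) * Real.sqrt (k / 2) := by
      rw [← Real.sqrt_mul (by positivity), show (2 : ℝ) * k * (k / 2) = k ^ 2 by ring,
        Real.sqrt_sq hk0.le]
    have h4 : Real.sqrt (2 * k) ≠ 0 := (Real.sqrt_pos.2 (by positivity)).ne'
    rw [ha, div_mul_eq_mul_div, div_eq_iff h4]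
    conv_lhs => rw [h3]
    ring
  rw [h2]

/-- Lower bound for the expected maximum of a process with large increments. -/
lemma le_integral_iSup_of_le_increments (hX : IsContinuousCenteredGaussian X P) {C H : ℝ}
    (hC : 0 < C) (hH : 0 < H)
    (h : ∀ t s : I, ENNReal.ofReal (C * |(t : ℝ) - s| ^ H) ≤ eLpNorm (X t - X s) 2 P) :
    C / Real.sqrt (4 * H * Real.pi * Real.exp 1 * Real.log 2) ≤ ∫ ω, ⨆ t, X t ω ∂P := by
  have hl2 : 0 < Real.log 2 := Real.log_pos (by norm_num)
  have hl3 : 0 < Real.log 3 := Real.log_pos (by norm_num)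
  have hpi := Real.pi_pos
  have h32 : 16 * Real.log 3 ≤ 27 * Real.log 2 := by
    have h1 : Real.log ((3 : ℝ) ^ 16) ≤ Real.log ((2 : ℝ) ^ 27) :=
      Real.log_le_log (by norm_num) (by norm_num)
    rw [Real.log_pow, Real.log_pow] at h1
    exact_mod_cast h1
  -- With s = 2Hk log 3, the square of the grid bound divided by the target is (9/4)(log 2 / log 3)
  -- · s exp(1 - s). The optimum s = 1 would need k = 1/(2H log 3), hence the floor. Two weights per
  -- level would give s exp(1 - s) ≤ 1 with s = 2Hk log 2, leaving no room for rounding; three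
  -- weights give the slack (9/4)(log 2 / log 3) > 4/3.
  rcases le_or_gt (2 * H * Real.log 3) 1 with hcase | hcase
  · set x : ℝ := 1 / (2 * H * Real.log 3) with hx
    have hx1 : 1 ≤ x := (one_le_div (by positivity)).2 hcase
    set k := ⌊x⌋₊ with hk
    have hk1 : (1 : ℝ) ≤ k := by exact_mod_cast Nat.le_floor (by exact_mod_cast hx1)
    have hkx : (k : ℝ) ≤ x := Nat.floor_le (by linarith)
    have hxk : x < k + 1 := Nat.lt_floor_add_one x
    have hxm : 2 * H * Real.log 3 * x = 1 := by
      rw [hx]; field_simp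
    set s : ℝ := 2 * H * Real.log 3 * k with hs
    have hpos : 0 < 2 * H * Real.log 3 := by positivity
    have hs1 : s ≤ 1 := by
      rw [← hxm]; exact mul_le_mul_of_nonneg_left hkx hpos.le
    -- Since x ≥ 1, its integer part is at least x/2.
    have hs2 : 1 / 2 ≤ s := by
      have h1 : x / 2 ≤ k := by linarith
      have h2 := mul_le_mul_of_nonneg_left h1 hpos.le
      linarith
    refine le_trans ?_ (hX.le_integral_iSup_of_grid hC hH h k)
    have hpow : ((3 : ℝ) ^ k)⁻¹ ^ H = Real.exp (-s / 2) := by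
      rw [← Real.rpow_natCast 3, ← Real.rpow_neg (by norm_num), ← Real.rpow_mul (by norm_num),
        Real.rpow_def_of_pos (by norm_num), hs]
      congr 1
      ring
    have hmain : 1 ≤ Real.sqrt (4 * H * Real.pi * Real.exp 1 * Real.log 2) *
        (Real.exp (-s / 2) * Real.sqrt (k / 2) * (3 / (2 * Real.sqrt Real.pi))) := by
      refine one_le_sq_iff₀ (by positivity) |>.1 ?_
      rw [mul_pow, mul_pow, mul_pow, div_pow, mul_pow, Real.sq_sqrt (by positivity),
        Real.sq_sqrt (by positivity), Real.sq_sqrt hpi.le, ← Real.exp_nat_mul]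
      have he : Real.exp 1 * Real.exp ((2 : ℕ) * (-s / 2)) = Real.exp (1 - s) := by
        rw [← Real.exp_add]; congr 1; push_cast; ring
      have h1 : 4 * H * Real.pi * Real.exp 1 * Real.log 2 *
          (Real.exp ((2 : ℕ) * (-s / 2)) * (k / 2) * (3 ^ 2 / (2 ^ 2 * Real.pi))) =
          9 / 2 * (H * k) * Real.log 2 * Real.exp (1 - s) := by
        rw [← he]
        field_simp
        norm_num
      rw [h1]
      have h2 : 2 - s ≤ Real.exp (1 - s) := by linarith [Real.add_one_le_exp (1 - s)]
      -- The lower bound s(2 - s) is at least 3/4 on [1/2, 1], which the slack absorbs exactly: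
      -- (9/4)(16/27)(3/4) = 1.
      have h3 : 3 / 4 ≤ s * Real.exp (1 - s) := by
        have h4 : s * (2 - s) ≤ s * Real.exp (1 - s) :=
          mul_le_mul_of_nonneg_left h2 (by linarith)
        nlinarith
      have h5 : 9 / 2 * (H * k) * Real.log 2 * Real.exp (1 - s) =
          9 / 4 * (Real.log 2 / Real.log 3) * (s * Real.exp (1 - s)) := by
        rw [hs]; field_simp; norm_num
      rw [h5]
      have h6 : 16 / 27 ≤ Real.log 2 / Real.log 3 := by
        rw [div_le_div_iff₀ (by norm_num) hl3]; linarith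
      calc (1 : ℝ) = 9 / 4 * (16 / 27) * (3 / 4) := by norm_num
        _ ≤ _ := by gcongr
    rw [hpow, div_le_iff₀ (Real.sqrt_pos.2 (by positivity))]
    calc C = C * 1 := (mul_one C).symm
      _ ≤ C * (Real.sqrt (4 * H * Real.pi * Real.exp 1 * Real.log 2) *
        (Real.exp (-s / 2) * Real.sqrt (k / 2) * (3 / (2 * Real.sqrt Real.pi)))) := by gcongr
      _ = _ := by ring
  -- Here 2H log 3 > 1, and e log 2 ≥ log 3 gives 2π ≤ 4Hπ e log 2, so the endpoint bound C/√(2π)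
  -- already suffices.
  · refine le_trans ?_ hX.le_integral_iSup_of_endpoints
    have h1 : C ≤ canonicalDist X P 0 1 := by
      have h2 := hX.le_canonicalDist (h 0 1)
      simpa using h2
    refine div_le_div₀ (canonicalDist_nonneg _ _) h1 (Real.sqrt_pos.2 (by positivity))
      (Real.sqrt_le_sqrt ?_)
    have he := Real.exp_one_gt_d9
    have h2 : 2 * Real.log 2 ≤ Real.exp 1 * Real.log 2 := by gcongr; linarith
    have h3 : Real.log 3 ≤ Real.exp 1 * Real.log 2 := by linarith
    have h4 : 1 ≤ 2 * H * (Real.exp 1 * Real.log 2) :=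
      hcase.le.trans (mul_le_mul_of_nonneg_left h3 (by positivity))
    calc 2 * Real.pi = 2 * Real.pi * 1 := (mul_one _).symm
      _ ≤ 2 * Real.pi * (2 * H * (Real.exp 1 * Real.log 2)) := by gcongr
      _ = _ := by ring

end IsContinuousCenteredGaussian

lemma div_five_mul_sqrt_lt {C H : ℝ} (hC : 0 < C) (hH : 0 < H) :
    C / (5 * Real.sqrt H) < C / Real.sqrt (4 * H * Real.pi * Real.exp 1 * Real.log 2) := by
  have hl := Real.log_two_lt_d9
  have hl0 : 0 < Real.log 2 := Real.log_pos (by norm_num)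
  have he := Real.exp_one_lt_d9
  have hpi := Real.pi_lt_d4
  have hpi0 := Real.pi_pos
  refine div_lt_div_of_pos_left hC (Real.sqrt_pos.2 (by positivity)) ?_
  have h5 : 5 * Real.sqrt H = Real.sqrt (25 * H) := by
    rw [Real.sqrt_mul (by norm_num), show (25 : ℝ) = 5 ^ 2 by norm_num,
      Real.sqrt_sq (by norm_num)]
  rw [h5]
  refine Real.sqrt_lt_sqrt (by positivity) ?_
  have h1 : Real.pi * Real.exp 1 < 3.1416 * 2.7183 :=
    mul_lt_mul'' hpi (by linarith) hpi0.le (Real.exp_pos 1).le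
  have h2 : Real.pi * Real.exp 1 * Real.log 2 < 3.1416 * 2.7183 * 0.6932 :=
    mul_lt_mul'' h1 (by linarith) (by positivity) hl0.le
  have h3 : 4 * (Real.pi * Real.exp 1 * Real.log 2) < 25 := by
    norm_num at h2
    linarith
  calc 4 * H * Real.pi * Real.exp 1 * Real.log 2
      = 4 * (Real.pi * Real.exp 1 * Real.log 2) * H := by ring
    _ < 25 * H := by gcongr

end LowerBound

theorem theorem1 :
    (∀ (Ω : Type u) [MeasurableSpace Ω] (P : Measure Ω) [IsProbabilityMeasure P]
        (X : I → Ω → ℝ) (_ : IsContinuousCenteredGaussian X P)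
        (C H : ℝ) (_ : 0 < C) (_ : 0 < H) (_ : H < 1),
        (∀ t s : I, ENNReal.ofReal (C * |(t : ℝ) - s| ^ H) ≤ eLpNorm (X t - X s) 2 P) →
        Integrable (fun ω => ⨆ t, X t ω) P ∧
        C / Real.sqrt (4 * H * Real.pi * Real.exp 1 * Real.log 2) ≤ ∫ ω, ⨆ t, X t ω ∂P ∧
        C / (5 * Real.sqrt H) < C / Real.sqrt (4 * H * Real.pi * Real.exp 1 * Real.log 2)) ∧
    (∃ L : ℝ, 0 < L ∧ L < 3.75 ∧ GenericChainingBound.{u} L ∧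
      ∀ (Ω : Type u) [MeasurableSpace Ω] (P : Measure Ω) [IsProbabilityMeasure P]
        (X : I → Ω → ℝ) (_ : IsContinuousCenteredGaussian X P)
        (C H : ℝ) (_ : 0 < C) (_ : 0 < H) (_ : H < 1),
        (∀ t s : I, eLpNorm (X t - X s) 2 P ≤ ENNReal.ofReal (C * |(t : ℝ) - s| ^ H)) →
        Integrable (fun ω => ⨆ t, X t ω) P ∧
        ∫ ω, ⨆ t, X t ω ∂P ≤
          L * C * Real.sqrt (2 * Real.pi / (H * Real.log 2 ^ 3)) *
            erfc (Real.sqrt (Real.log 2 / 2 * H)) ∧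
        L * C * Real.sqrt (2 * Real.pi / (H * Real.log 2 ^ 3)) *
            erfc (Real.sqrt (Real.log 2 / 2 * H)) < 16.3 * C / Real.sqrt H) := by

  refine ⟨fun Ω _ P _ X hX C H hC hH _ h => ⟨hX.integrable_iSup_univ,
      hX.le_integral_iSup_of_le_increments hC hH h, div_five_mul_sqrt_lt hC hH⟩,
    chainingConstant, chainingConstant_pos, chainingConstant_lt,
    genericChainingBound_chainingConstant, fun Ω _ P _ X hX C H hC hH _ h =>
      ⟨hX.integrable_iSup_univ, hX.integral_iSup_le_of_holder hC hH h,
        chainingConstant_mul_lt hC hH⟩⟩
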